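/- **Theorem (almost sure convergence with unknown feedback probabilities).** Consider a game with players $i=1,\dots,N$, action sets $\mathcal A_i\subset\mathbb R^{d_i}$ (with $d_i\ge 1$) that are compact and convex with nonempty interior, $\mathcal A=\prod_i\mathcal A_i$, and utilities $u_i:\mathcal A\to\mathbb R$ such that, for each $i$: $u_i$ is continuous on $\mathcal A$; $u_i(a_i,a_{-i})$ is concave and continuously differentiable in $a_i\in\mathcal A_i$ for every fixed $a_{-i}$; and the partial gradient $g_i(a)=\nabla_{a_i}u_i(a_i,a_{-i})$ is Lipschitz continuous in $a\in\mathcal A$. Suppose the game is strictly monotone: $\sum_i\langle g_i(a)-g_i(a'),a_i-a_i'\rangle<0$ for all $a\ne a'$ in $\mathcal A$. Let $c_i\in\mathcal A_i$ and $r_i>0$ with $\mathbb B_{r_i}(c_i)\subseteq\mathcal A_i$. The players run the following algorithm from a (possibly random) initial profile $a_1\in\mathcal A$. At stage $k=1,2,\dots$ each player $i$ draws $\lambda_{i,k}$ uniformly from the unit sphere of $\mathbb R^{d_i}$ and plays $$\hat a_{i,k}=a_{i,k}+\delta_k\bigl(\lambda_{i,k}-r_i^{-1}(a_{i,k}-c_i)\bigr).$$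 The value $u_i(\hat a_k)$, where $\hat a_k=(\hat a_{1,k},\dots,\hat a_{N,k})$, is received by player $i$ if $I_i^k=1$ and lost if $I_i^k=0$. With $\hat g_{i,k}=\frac{d_i}{\delta_k}u_i(\hat a_k)\lambda_{i,k}$ and $P_{\mathcal A_i}$ the Euclidean projection onto $\mathcal A_i$, $$a_{i,k+1}=P_{\mathcal A_i}\bigl(a_{i,k}+\gamma_{i,k}\hat g_{i,k}\bigr)\ \text{ if } I_i^k=1,\qquad a_{i,k+1}=a_{i,k}\ \text{ if } I_i^k=0,$$ with step sizes $\gamma_{i,k}=1/(\Gamma_i^k)^q$, $\Gamma_i^k=\sum_{t=1}^kI_i^t$, where $q\in(1/2,1]$. The indicators satisfy $\mathbb P(I_i^k=1)=p_i>0$ for all $k$ (the $p_i$ are not used by the algorithm), and the random variables $a_1$, $\lambda_{i,k}$, $I_i^k$ ($1\le i\le N$, $k\ge1$) are mutually independent. Let $(\delta_k)$ be positive and non-increasing with $\delta_1<\min_ir_i$ and $$\lim_{k\to\infty}\delta_k=0,\qquad \sum_{k=1}^\infty k^{-q}\delta_k<\infty,\qquad \sum_{k=1}^\infty k^{-2q}\delta_k^{-2}<\infty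 .$$ Then the game has a unique Nash equilibrium $a^*$ (a point $a^*\in\mathcal A$ with $u_i(a_i^*,a_{-i}^*)\ge u_i(a_i,a_{-i}^*)$ for all $i$ and all $a_i\in\mathcal A_i$), and the realized actions $\hat a_k$ converge to $a^*$ with probability $1$. -/

import Mathlib

open MeasureTheory ProbabilityTheory Filter Topology

/-- The Euclidean norm of a profile `x = (x₁, …, x_N)` of Euclidean vectors. -/
noncomputable def profileNorm {N : ℕ} {d : Fin N → ℕ}
    (x : ∀ i, EuclideanSpace ℝ (Fin (d i))) : ℝ :=
  Real.sqrt (∑ i, ‖x i‖ ^ 2)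

/-- An `N`-player utility maximization game: action dimensions `dim i`, action sets
`act i ⊆ ℝ^(dim i)` and utilities `util i`. Only the values of `util i` at profiles
of actions (all `a j ∈ act j`) are ever used. -/
structure Game (N : ℕ) where
  dim : Fin N → ℕ
  act : ∀ i, Set (EuclideanSpace ℝ (Fin (dim i)))
  util : Fin N → (∀ j, EuclideanSpace ℝ (Fin (dim j))) → ℝ

namespace Game

variable {N : ℕ} (G : Game N)

/-- Ambient space `∏ ℝ^(dim i)` of action profiles. -/
abbrev Profile : Type := ∀ i, EuclideanSpace ℝ (Fin (G.dim i))

/-- The set `∏ᵢ Aᵢ` of action profiles. -/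
def profiles : Set G.Profile := {a | ∀ i, a i ∈ G.act i}

/-- Partial gradient of `uᵢ` in player `i`'s own action, taken within `Aᵢ`
(at boundary points of `Aᵢ` only directions from inside `Aᵢ` are available). -/
noncomputable def grad (i : Fin N) (a : G.Profile) : EuclideanSpace ℝ (Fin (G.dim i)) :=
  gradientWithin (fun x => G.util i (Function.update a i x)) (G.act i) (a i)

/-- Standing assumptions on the action sets and the utilities. -/
structure Regular : Prop where
  compact : ∀ i, IsCompact (G.act i)
  convex : ∀ i, Convex ℝ (G.act i)
  interior_nonempty : ∀ i, (interior (G.act i)).Nonempty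
  util_continuous : ∀ i, ContinuousOn (G.util i) G.profiles
  util_concave : ∀ i, ∀ a ∈ G.profiles,
    ConcaveOn ℝ (G.act i) (fun x => G.util i (Function.update a i x))
  util_contDiff : ∀ i, ∀ a ∈ G.profiles,
    ContDiffOn ℝ 1 (fun x => G.util i (Function.update a i x)) (G.act i)
  grad_lipschitz : ∀ i, ∃ L : ℝ, ∀ a ∈ G.profiles, ∀ b ∈ G.profiles,
    ‖G.grad i a - G.grad i b‖ ≤ L * profileNorm (a - b)

/-- Strict monotonicity: `⟨g(a) - g(b), a - b⟩ < 0` for distinct action profiles. -/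
def StrictlyMonotone : Prop :=
  ∀ a ∈ G.profiles, ∀ b ∈ G.profiles, a ≠ b →
    ∑ i, inner ℝ (G.grad i a - G.grad i b) (a i - b i) < 0

/-- Nash equilibrium. -/
def IsNash (a : G.Profile) : Prop :=
  a ∈ G.profiles ∧ ∀ i, ∀ x ∈ G.act i, G.util i (Function.update a i x) ≤ G.util i a

end Game

/-- Euclidean projection onto `A`: a point of `A` nearest to `y`
(it exists and is unique when `A` is nonempty, closed and convex). -/
noncomputable def projOn {d : ℕ} (A : Set (EuclideanSpace ℝ (Fin d)))
    (y : EuclideanSpace ℝ (Fin d)) : EuclideanSpace ℝ (Fin d) :=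
  Classical.epsilon fun x => x ∈ A ∧ ∀ z ∈ A, ‖y - x‖ ≤ ‖y - z‖

/-- The uniform probability distribution on the unit sphere of `ℝ^d` (for `d ≥ 1`), as a
measure on `ℝ^d`: the normalized surface measure. -/
noncomputable def unifSphere (d : ℕ) : Measure (EuclideanSpace ℝ (Fin d)) :=
  ((((volume : Measure (EuclideanSpace ℝ (Fin d))).toSphere Set.univ)⁻¹) •
    (volume : Measure (EuclideanSpace ℝ (Fin d))).toSphere).map Subtype.val

/-! ### The algorithm

Time is indexed by `n : ℕ`; index `n` is stage `k = n + 1`. -/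

/-- Number of feedbacks received by a player in stages `1, …, n + 1` (current one included). -/
def feedbackCount (J : ℕ → Bool) (n : ℕ) : ℕ :=
  ∑ t ∈ Finset.range (n + 1), if J t = true then 1 else 0

/-- Step size `1 / Γ^q`, where `Γ` is the number of feedbacks received so far. It is only used
at stages with a feedback, where `Γ ≥ 1`. -/
noncomputable def stepSize (q : ℝ) (J : ℕ → Bool) (n : ℕ) : ℝ :=
  1 / (feedbackCount J n : ℝ) ^ q

namespace Game

variable {N : ℕ} (G : Game N)

/-- Applied actions `âᵢ = aᵢ + δ θᵢ` with `θᵢ = λᵢ - rᵢ⁻¹ (aᵢ - cᵢ)`, for intended actions `a`,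
directions `l`, radius `δ` and safety balls of centres `c` and radii `r`. -/
noncomputable def perturb (c : G.Profile) (r : Fin N → ℝ) (δ : ℝ) (a l : G.Profile) :
    G.Profile :=
  fun i => a i + δ • (l i - (r i)⁻¹ • (a i - c i))

/-- One-point gradient estimates `ĝᵢ = (dᵢ / δ) uᵢ(â) λᵢ`. -/
noncomputable def gradEst (δ : ℝ) (aHat l : G.Profile) : G.Profile :=
  fun i => ((G.dim i : ℝ) / δ * G.util i aHat) • l i

/-- The intended actions generated by the algorithm from the initial profile `a₁`, along given
sequences of directions `l` and of feedback indicators `J` (`true`: feedback received). -/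
noncomputable def intended (c : G.Profile) (r : Fin N → ℝ) (δ : ℕ → ℝ) (q : ℝ)
    (a₁ : G.Profile) (l : ℕ → G.Profile) (J : Fin N → ℕ → Bool) : ℕ → G.Profile
  | 0 => a₁
  | n + 1 => fun i =>
      let a := intended c r δ q a₁ l J n
      if J i n = true then
        projOn (G.act i)
          (a i + stepSize q (J i) n • G.gradEst (δ n) (G.perturb c r (δ n) a (l n)) (l n) i)
      else a i

/-- The realized (applied) actions `â` of the algorithm. -/
noncomputable def realized (c : G.Profile) (r : Fin N → ℝ) (δ : ℕ → ℝ) (q : ℝ)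
    (a₁ : G.Profile) (l : ℕ → G.Profile) (J : Fin N → ℕ → Bool) (n : ℕ) : G.Profile :=
  G.perturb c r (δ n) (G.intended c r δ q a₁ l J n) (l n)

end Game

/-- The sources of randomness: the initial profile, the direction of each player at each stage,
and the feedback indicator of each player at each stage. -/
inductive Source (N : ℕ) where
  | init : Source N
  | dir : Fin N → ℕ → Source N
  | feedback : Fin N → ℕ → Source N

/-- The σ-algebra generated by each source of randomness. -/
@[reducible]
def sourceSigma {Ω : Type*} {N : ℕ} (G : Game N) (a₁ : Ω → G.Profile)
    (lam : ∀ i, ℕ → Ω → EuclideanSpace ℝ (Fin (G.dim i))) (I : Fin N → ℕ → Ω → Bool) :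
    Source N → MeasurableSpace Ω
  | .init => MeasurableSpace.comap a₁ inferInstance
  | .dir i n => MeasurableSpace.comap (lam i n) inferInstance
  | .feedback i n => MeasurableSpace.comap (I i n) inferInstance

/-- The probabilistic model: the (possibly random) initial profile is feasible, the directions
are uniform on the unit spheres, player `i` receives each feedback with probability
`p i > 0`, and all these random variables are mutually independent. -/
structure LossyModel {Ω : Type*} [MeasurableSpace Ω] (P : Measure Ω) {N : ℕ} (G : Game N)
    (p : Fin N → ℝ) (a₁ : Ω → G.Profile)
    (lam : ∀ i, ℕ → Ω → EuclideanSpace ℝ (Fin (G.dim i)))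
    (I : Fin N → ℕ → Ω → Bool) : Prop where
  init_measurable : Measurable a₁
  init_mem : ∀ ω, a₁ ω ∈ G.profiles
  dir_measurable : ∀ i n, Measurable (lam i n)
  dir_law : ∀ i n, P.map (lam i n) = unifSphere (G.dim i)
  feedback_measurable : ∀ i n, Measurable (I i n)
  feedback_prob : ∀ i n, P {ω | I i n ω = true} = ENNReal.ofReal (p i)
  prob_pos : ∀ i, 0 < p i
  indep : iIndep (sourceSigma G a₁ lam I) P

/-! Equilibria are the solutions of the variational inequality of the pseudo-gradient: concavity
makes the first-order condition sufficient (`isNash_iff`). Existence follows by regularizing a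
monotone inequality into strongly monotone ones; uniqueness comes from strict monotonicity.

For convergence, player `i` receives about `p i * k` feedbacks up to stage `k`, so the step is about
`(p i * k) ^ (-q)` and is taken with probability `p i`. The mean speed is therefore `p i ^ (1 - q) *
k ^ (-q)`, which differs between players. Weighting the squared distances to the equilibrium `b` by
`p i ^ (q - 1)` restores the common rate `k ^ (-q)`, and the drift of the Lyapunov function is `2 *
k ^ (-q)` times the sum of `⟨gᵢ(a), aᵢ - bᵢ⟩`, which is negative off `b` (`sum_inner_grad_neg`).

The observed value splits into a part independent of the player's own direction, a part `δ ⟨gᵢ(a),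
λᵢ⟩`, and a remainder of order `δ²` (`exists_expansion`). After multiplication by `d λᵢ / δ` these
give a centered noise of size `1 / δ`, a term with mean `gᵢ` and bounded fluctuation, and a bias of
order `δ`. The two noises are martingale transforms bounded in L² (`ae_exists_tendsto_sum_mul`); the
bias and the squared steps are summable.

The actual step depends on the current indicator and has no good deterministic bound. It is replaced
by `truncStep`, which is predictable and of order `k ^ (-q)`, and which by the law of large numbers
eventually agrees with the true step whenever feedback arrives. Its distance to the deterministic
equivalent is summable because the count deviates from its mean by order `√k` in expectation.

Hence, path by path, the Lyapunov function decreases up to a convergent series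
(`tendsto_of_perturbed_descent`). It converges, and since `∑ k ^ (-q)` diverges, compactness forces
its limit to be zero. -/

/-! ### Convergence of series and of perturbed descent recursions -/

/-- A martingale transform `∑ Yₖ Zₖ` of bounded centered innovations `Zₖ`, independent of the
past, by predictable weights with square-summable bounds converges almost surely. -/
theorem ae_exists_tendsto_sum_mul {Ω : Type*} [m0 : MeasurableSpace Ω] {P : Measure Ω}
    [IsProbabilityMeasure P] (ℱ : Filtration ℕ m0) {Y Z : ℕ → Ω → ℝ} {c : ℕ → ℝ} {B : ℝ}
    (hY : ∀ n, Measurable[ℱ n] (Y n)) (hYb : ∀ n ω, |Y n ω| ≤ c n)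
    (hc : Summable fun n => c n ^ 2) (hZ : ∀ n, Measurable[ℱ (n + 1)] (Z n))
    (hZb : ∀ n ω, |Z n ω| ≤ B)
    (hind : ∀ n, Indep (MeasurableSpace.comap (Z n) inferInstance) (ℱ n) P)
    (hmean : ∀ n, ∫ ω, Z n ω ∂P = 0) :
    ∀ᵐ ω ∂P, ∃ l, Tendsto (fun n => ∑ k ∈ Finset.range n, Y k ω * Z k ω) atTop (𝓝 l) := by
  set M : ℕ → Ω → ℝ := fun n ω => ∑ k ∈ Finset.range n, Y k ω * Z k ω with hM
  have hc0 : ∀ n ω, 0 ≤ c n := fun n ω => (abs_nonneg _).trans (hYb n ω)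
  have hMm : ∀ n, Measurable[ℱ n] (M n) := by
    intro n
    refine Finset.measurable_fun_sum _ fun k hk => ?_
    have hk' : k + 1 ≤ n := Finset.mem_range.1 hk
    exact ((hY k).mono (ℱ.mono (by omega)) le_rfl).mul ((hZ k).mono (ℱ.mono hk') le_rfl)
  have hMm' : ∀ n, Measurable (M n) := fun n => (hMm n).mono (ℱ.le n) le_rfl
  have hYm' : ∀ n, Measurable (Y n) := fun n => (hY n).mono (ℱ.le n) le_rfl
  have hZm' : ∀ n, Measurable (Z n) := fun n => (hZ n).mono (ℱ.le _) le_rfl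
  have hMb : ∀ n ω, |M n ω| ≤ ∑ k ∈ Finset.range n, c k * B := by
    intro n ω
    refine (Finset.abs_sum_le_sum_abs _ _).trans (Finset.sum_le_sum fun k _ => ?_)
    rw [abs_mul]
    exact mul_le_mul (hYb k ω) (hZb k ω) (abs_nonneg _) (hc0 k ω)
  have hbint : ∀ {f : Ω → ℝ} (C : ℝ), Measurable f → (∀ ω, |f ω| ≤ C) → Integrable f P :=
    fun C hf hb => Integrable.of_bound hf.aestronglyMeasurable C (Eventually.of_forall hb)
  have hMint : ∀ n, Integrable (M n) P := fun n => hbint _ (hMm' n) (hMb n)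
  -- Used twice: with an indicator for the martingale property, and with `M n * Y n` for the
  -- orthogonality of the increments.
  have hzero : ∀ n (W : Ω → ℝ), Measurable[ℱ n] W → ∫ ω, W ω * Z n ω ∂P = 0 := by
    intro n W hW
    have h : IndepFun W (Z n) P := by
      rw [IndepFun_iff_Indep]
      exact indep_of_indep_of_le_left (hind n).symm hW.comap_le
    rw [h.integral_fun_mul_eq_mul_integral (hW.mono (ℱ.le n) le_rfl).aestronglyMeasurable
      (hZm' n).aestronglyMeasurable, hmean n, mul_zero]
  have hmart : Martingale M ℱ P := by
    refine martingale_of_setIntegral_eq_succ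
      (fun n => (hMm n).stronglyMeasurable) hMint fun n s hs => ?_
    have hs' := ℱ.le n _ hs
    have hYZ : Integrable (fun ω => Y n ω * Z n ω) P :=
      hbint (c n * B) ((hYm' n).mul (hZm' n)) fun ω => by
        rw [abs_mul]; exact mul_le_mul (hYb n ω) (hZb n ω) (abs_nonneg _) (hc0 n ω)
    have : M (n + 1) = fun ω => M n ω + Y n ω * Z n ω := by
      funext ω; simp [hM, Finset.sum_range_succ]
    rw [this, integral_add (hMint n).integrableOn hYZ.integrableOn, left_eq_add,
      ← integral_indicator hs']
    have h2 := hzero n (s.indicator (Y n)) ((hY n).indicator hs)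
    rw [← h2]
    congr 1; funext ω
    by_cases h : ω ∈ s <;> simp [h]
  have hsq : ∀ n, ∫ ω, M n ω ^ 2 ∂P ≤ ∑ k ∈ Finset.range n, (c k * B) ^ 2 := by
    intro n
    induction n with
    | zero => simp [hM]
    | succ n ih =>
      have hsplit : ∀ ω, M (n + 1) ω ^ 2
          = M n ω ^ 2 + 2 * ((M n ω * Y n ω) * Z n ω) + (Y n ω * Z n ω) ^ 2 := by
        intro ω; simp only [hM, Finset.sum_range_succ]; ring
      have hi1 : Integrable (fun ω => M n ω ^ 2) P :=
        hbint ((∑ k ∈ Finset.range n, c k * B) ^ 2) ((hMm' n).pow_const 2) fun ω => by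
          rw [abs_pow]; exact pow_le_pow_left₀ (abs_nonneg _) (hMb n ω) 2
      have hi2 : Integrable (fun ω => 2 * ((M n ω * Y n ω) * Z n ω)) P := by
        refine Integrable.const_mul
          (hbint ((∑ k ∈ Finset.range n, c k * B) * c n * B)
            (((hMm' n).mul (hYm' n)).mul (hZm' n)) fun ω => ?_) 2
        rw [Pi.mul_apply, Pi.mul_apply, abs_mul, abs_mul]
        have h0 := (abs_nonneg _).trans (hMb n ω)
        exact mul_le_mul (mul_le_mul (hMb n ω) (hYb n ω) (abs_nonneg _) h0) (hZb n ω)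
          (abs_nonneg _) (mul_nonneg h0 (hc0 n ω))
      have hb3 : ∀ ω, (Y n ω * Z n ω) ^ 2 ≤ (c n * B) ^ 2 := fun ω => by
        rw [← sq_abs, abs_mul]
        exact pow_le_pow_left₀ (by positivity)
          (mul_le_mul (hYb n ω) (hZb n ω) (abs_nonneg _) (hc0 n ω)) 2
      have hi3 : Integrable (fun ω => (Y n ω * Z n ω) ^ 2) P :=
        hbint ((c n * B) ^ 2) (((hYm' n).mul (hZm' n)).pow_const 2) fun ω => by
          rw [abs_of_nonneg (sq_nonneg _)]; exact hb3 ω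
      have h3 : ∫ ω, (Y n ω * Z n ω) ^ 2 ∂P ≤ (c n * B) ^ 2 := by
        refine (integral_mono hi3 (integrable_const ((c n * B) ^ 2)) hb3).trans ?_
        simp
      simp only [hsplit]
      rw [integral_add (by exact hi1.add hi2) hi3, integral_add hi1 hi2, integral_const_mul,
        hzero n (fun ω => M n ω * Y n ω) ((hMm n).mul (hY n)), Finset.sum_range_succ]
      linarith
  have hsum : Summable fun k => (c k * B) ^ 2 := by
    simp only [mul_pow]; exact hc.mul_right _
  -- The L² bound becomes an L¹ bound through `|x| ≤ 1 + x ^ 2`, as required by the convergence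
  -- theorem for submartingales.
  set R : ℝ := 1 + ∑' k, (c k * B) ^ 2
  have hR : ∀ n, ∫ ω, ‖M n ω‖ ∂P ≤ R := by
    intro n
    have hi1 : Integrable (fun ω => M n ω ^ 2) P :=
      hbint ((∑ k ∈ Finset.range n, c k * B) ^ 2) ((hMm' n).pow_const 2) fun ω => by
        rw [abs_pow]; exact pow_le_pow_left₀ (abs_nonneg _) (hMb n ω) 2
    have h1 : ∫ ω, ‖M n ω‖ ∂P ≤ ∫ ω, (1 + M n ω ^ 2) ∂P := by
      refine integral_mono (hMint n).norm ((integrable_const 1).add hi1) fun ω => ?_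
      simp only [Real.norm_eq_abs]
      nlinarith [sq_nonneg (|M n ω| - 1), sq_abs (M n ω)]
    rw [integral_add (integrable_const 1) hi1] at h1
    have h2 := hsum.sum_le_tsum (Finset.range n) (fun _ _ => sq_nonneg _)
    simp at h1
    have h3 := hsq n
    simp only [Real.norm_eq_abs, R]
    linarith
  have hL1 : ∀ n, eLpNorm (M n) 1 P ≤ (R.toNNReal : ENNReal) := by
    intro n
    rw [eLpNorm_one_eq_lintegral_enorm, ← ofReal_integral_norm_eq_lintegral_enorm (hMint n)]
    exact ENNReal.ofReal_le_ofReal (hR n)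
  filter_upwards [hmart.submartingale.ae_tendsto_limitProcess hL1] with ω hω
  exact ⟨_, hω⟩

/-- A nonnegative sequence which decreases up to a convergent series of errors converges, and its
decrements come close to vanishing infinitely often. -/
theorem tendsto_of_perturbed_descent {V φ s e : ℕ → ℝ} {S : ℝ}
    (hV : ∀ n, 0 ≤ V n) (hφ : ∀ n, 0 ≤ φ n) (hs : ∀ n, 0 ≤ s n) (hdiv : ¬ Summable s)
    (he : Tendsto (fun n => ∑ k ∈ Finset.range n, e k) atTop (𝓝 S))
    (hstep : ∀ᶠ n in atTop, V (n + 1) ≤ V n - s n * φ n + e n) :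
    (∃ v, Tendsto V atTop (𝓝 v)) ∧ ∀ ε > 0, ∃ᶠ n in atTop, φ n < ε := by
  obtain ⟨n₀, hn₀⟩ := eventually_atTop.1 hstep
  -- Subtracting the partial sums of the errors leaves a sequence that is decreasing and bounded
  -- below.
  set W : ℕ → ℝ := fun n => V (n + n₀) - ∑ k ∈ Finset.range (n + n₀), e k with hW
  have hWstep : ∀ n, s (n + n₀) * φ (n + n₀) ≤ W n - W (n + 1) := by
    intro n
    have h := hn₀ (n + n₀) (by omega)
    simp only [hW, show n + 1 + n₀ = n + n₀ + 1 by ring, Finset.sum_range_succ]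
    linarith
  have hWanti : Antitone W := antitone_nat_of_succ_le fun n => by
    have := hWstep n
    have := mul_nonneg (hs (n + n₀)) (hφ (n + n₀))
    linarith
  have he' := (tendsto_add_atTop_iff_nat n₀).2 he
  obtain ⟨C, hC⟩ := he'.bddAbove_range
  have hWb : ∀ n, -C ≤ W n := fun n => by
    have h1 := hC ⟨n, rfl⟩
    have h2 := hV (n + n₀)
    simp only [hW] at h1 ⊢
    linarith
  have hWlim : ∃ w, Tendsto W atTop (𝓝 w) :=
    ⟨_, tendsto_atTop_ciInf hWanti ⟨-C, by rintro _ ⟨n, rfl⟩; exact hWb n⟩⟩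
  obtain ⟨w, hw⟩ := hWlim
  refine ⟨⟨w + S, (tendsto_add_atTop_iff_nat n₀).1 ?_⟩, fun ε hε => ?_⟩
  · have := hw.add he'
    simpa [hW] using this
  · by_contra hcon
    simp only [not_frequently, not_lt] at hcon
    apply hdiv
    have h1 : Summable fun n => s (n + n₀) * φ (n + n₀) := by
      refine summable_of_sum_range_le (c := W 0 + C)
        (fun n => mul_nonneg (hs _) (hφ _)) fun n => ?_
      refine (Finset.sum_le_sum fun k _ => hWstep k).trans ?_
      rw [Finset.sum_range_sub']
      linarith [hWb n]
    have h2 : Summable fun n => s n * φ n := (summable_nat_add_iff n₀).1 h1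
    refine Summable.of_norm_bounded_eventually_nat (h2.mul_left ε⁻¹) ?_
    filter_upwards [hcon] with n hn
    rw [Real.norm_of_nonneg (hs n)]
    rw [inv_mul_eq_div, le_div_iff₀ hε]
    exact mul_le_mul_of_nonneg_left hn (hs n)

/-! ### Monotone variational inequalities -/

theorem exists_proj {H : Type*} [NormedAddCommGroup H] [InnerProductSpace ℝ H] [CompleteSpace H]
    {K : Set H} (hK : IsClosed K) (hconv : Convex ℝ K) (hne : K.Nonempty) :
    ∃ p : H → H, ∀ y, p y ∈ K ∧ ∀ z ∈ K, inner ℝ (y - p y) (z - p y) ≤ 0 := by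
  have h : ∀ y, ∃ v ∈ K, ∀ z ∈ K, inner ℝ (y - v) (z - v) ≤ 0 := fun y => by
    obtain ⟨v, hv, hmin⟩ := exists_norm_eq_iInf_of_complete_convex hne hK.isComplete hconv y
    exact ⟨v, hv, (norm_eq_iInf_iff_real_inner_le_zero hconv hv).1 hmin⟩
  choose p hp using h
  exact ⟨p, hp⟩

/-- Adding the two angle conditions gives `‖u - v‖ ^ 2 ≤ ⟨x - y, u - v⟩`; Cauchy–Schwarz concludes.
With projections `u`, `v` of `x`, `y`, this is their nonexpansiveness. -/
theorem norm_sub_le_of_obtuse {H : Type*} [NormedAddCommGroup H] [InnerProductSpace ℝ H]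
    {x y u v : H} (hu : inner ℝ (x - u) (v - u) ≤ 0) (hv : inner ℝ (y - v) (u - v) ≤ 0) :
    ‖u - v‖ ≤ ‖x - y‖ := by
  have h1 : inner ℝ (u - v) (u - v) ≤ inner ℝ (x - y) (u - v) := by
    have : inner ℝ (x - y) (u - v) - inner ℝ (u - v) (u - v)
        = - inner ℝ (x - u) (v - u) - inner ℝ (y - v) (u - v) := by
      simp only [inner_sub_left, inner_sub_right, real_inner_comm]; ring
    linarith
  rw [real_inner_self_eq_norm_sq] at h1
  have h2 := real_inner_le_norm (x - y) (u - v)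
  by_contra! h
  nlinarith [norm_nonneg (u - v), norm_nonneg (x - y)]

/-- A strongly monotone Lipschitz variational inequality over a compact convex set is solvable. -/
theorem exists_strongly_monotone_vi {H : Type*} [NormedAddCommGroup H] [InnerProductSpace ℝ H]
    [CompleteSpace H] {K : Set H} (hK : IsCompact K) (hconv : Convex ℝ K) (hne : K.Nonempty)
    {F : H → H} {L ε : ℝ} (hε : 0 < ε)
    (hlip : ∀ x ∈ K, ∀ y ∈ K, ‖F x - F y‖ ≤ L * ‖x - y‖)
    (hmono : ∀ x ∈ K, ∀ y ∈ K, ε * ‖x - y‖ ^ 2 ≤ inner ℝ (F x - F y) (x - y)) :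
    ∃ x ∈ K, ∀ y ∈ K, 0 ≤ inner ℝ (F x) (y - x) := by
  obtain ⟨p, hp⟩ := exists_proj hK.isClosed hconv hne
  have hpl : ∀ x y, ‖p x - p y‖ ≤ ‖x - y‖ := fun x y =>
    norm_sub_le_of_obtuse ((hp x).2 _ (hp y).1) ((hp y).2 _ (hp x).1)
  -- With this `t` one has `t² L² ≤ t ε`, so the factor `1 - 2 t ε + t² L²` of the projected step is
  -- at most `κ < 1`. The summand `ε ^ 2` keeps the denominator positive when `L = 0`.
  set t : ℝ := ε / (L ^ 2 + ε ^ 2) with ht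
  have hden : 0 < L ^ 2 + ε ^ 2 := by positivity
  have htpos : 0 < t := div_pos hε hden
  set κ : ℝ := 1 - t * ε with hκ
  have hte : t * ε ≤ 1 := by
    rw [ht, div_mul_eq_mul_div, div_le_one hden]; nlinarith [sq_nonneg L]
  have htL : t ^ 2 * L ^ 2 ≤ t * ε := by
    have : t * (L ^ 2 + ε ^ 2) = ε := div_mul_cancel₀ _ hden.ne'
    nlinarith [sq_nonneg ε, mul_pos htpos htpos]
  set T : H → H := fun x => p (x - t • F x) with hT
  have hTK : ∀ x, T x ∈ K := fun x => (hp _).1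
  have hcontr : ∀ x ∈ K, ∀ y ∈ K, ‖T x - T y‖ ^ 2 ≤ κ * ‖x - y‖ ^ 2 := by
    intro x hx y hy
    have h1 : ‖T x - T y‖ ≤ ‖(x - y) - t • (F x - F y)‖ := by
      refine (hpl _ _).trans (le_of_eq ?_)
      congr 1; rw [smul_sub]; abel
    have h2 : ‖T x - T y‖ ^ 2 ≤ ‖(x - y) - t • (F x - F y)‖ ^ 2 :=
      pow_le_pow_left₀ (norm_nonneg _) h1 2
    rw [norm_sub_sq_real (x - y), norm_smul, inner_smul_right, real_inner_comm, mul_pow, Real.norm_eq_abs,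
      sq_abs] at h2
    have h3 := hmono x hx y hy
    have h4 : ‖F x - F y‖ ^ 2 ≤ L ^ 2 * ‖x - y‖ ^ 2 := by
      rw [← mul_pow]; exact pow_le_pow_left₀ (norm_nonneg _) (hlip x hx y hy) 2
    have h5 : t ^ 2 * ‖F x - F y‖ ^ 2 ≤ t * ε * ‖x - y‖ ^ 2 :=
      calc t ^ 2 * ‖F x - F y‖ ^ 2 ≤ t ^ 2 * (L ^ 2 * ‖x - y‖ ^ 2) := by gcongr
        _ = t ^ 2 * L ^ 2 * ‖x - y‖ ^ 2 := by ring
        _ ≤ _ := by gcongr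
    have h6 := mul_le_mul_of_nonneg_left h3 htpos.le
    rw [hκ]
    linarith
  have hFc : ContinuousOn F K := by
    refine (LipschitzOnWith.of_dist_le_mul (K := L.toNNReal) fun x hx y hy => ?_).continuousOn
    rw [dist_eq_norm, dist_eq_norm]
    exact (hlip x hx y hy).trans (by gcongr; exact Real.le_coe_toNNReal L)
  have hpc : Continuous p := by
    refine (LipschitzWith.of_dist_le_mul (K := 1) fun x y => ?_).continuous
    simpa [dist_eq_norm] using hpl x y
  have hTc : ContinuousOn T K := hpc.comp_continuousOn (by fun_prop)
  -- The fixed point is found by minimizing the displacement over the compact set: applying `T` once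
  -- more would shrink a nonzero minimum.
  obtain ⟨x, hx, hmin⟩ := hK.exists_isMinOn hne (f := fun x => ‖x - T x‖) (by fun_prop)
  have h1 : ‖x - T x‖ ^ 2 ≤ ‖T x - T (T x)‖ ^ 2 :=
    pow_le_pow_left₀ (norm_nonneg _) (hmin (hTK x)) 2
  have h2 := hcontr x hx (T x) (hTK x)
  have h3 : ‖x - T x‖ ^ 2 ≤ 0 := by
    have : 0 < t * ε := mul_pos htpos hε
    by_contra! h
    rw [hκ] at h2
    nlinarith
  have hfix : T x = x := by
    have : ‖x - T x‖ = 0 := by nlinarith [norm_nonneg (x - T x)]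
    exact (sub_eq_zero.1 (norm_eq_zero.1 this)).symm
  refine ⟨x, hx, fun y hy => ?_⟩
  have h4 := (hp (x - t • F x)).2 y hy
  change inner ℝ (x - t • F x - T x) (y - T x) ≤ 0 at h4
  rw [hfix, sub_sub_cancel_left, inner_neg_left, inner_smul_left] at h4
  simp at h4
  exact nonneg_of_mul_nonneg_right h4 htpos

/-- A monotone Lipschitz variational inequality over a compact convex set is solvable. -/
theorem exists_monotone_vi {H : Type*} [NormedAddCommGroup H] [InnerProductSpace ℝ H]
    [CompleteSpace H] {K : Set H} (hK : IsCompact K) (hconv : Convex ℝ K) (hne : K.Nonempty)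
    {F : H → H} {L : ℝ}
    (hlip : ∀ x ∈ K, ∀ y ∈ K, ‖F x - F y‖ ≤ L * ‖x - y‖)
    (hmono : ∀ x ∈ K, ∀ y ∈ K, 0 ≤ inner ℝ (F x - F y) (x - y)) :
    ∃ x ∈ K, ∀ y ∈ K, 0 ≤ inner ℝ (F x) (y - x) := by
  -- Tikhonov regularization: adding `x / (n + 1)` makes the field strongly monotone, and the
  -- inequality passes to a limit point of the regularized solutions.
  have hreg : ∀ n : ℕ, ∃ x ∈ K, ∀ y ∈ K,
      0 ≤ inner ℝ (F x + (1 / ((n : ℝ) + 1)) • x) (y - x) := by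
    intro n
    have hn : (0 : ℝ) < 1 / ((n : ℝ) + 1) := by positivity
    refine exists_strongly_monotone_vi hK hconv hne (L := L + 1 / ((n : ℝ) + 1)) hn ?_ ?_
    · intro x hx y hy
      rw [add_sub_add_comm, ← smul_sub, add_mul]
      refine (norm_add_le _ _).trans (add_le_add (hlip x hx y hy) ?_)
      rw [norm_smul, Real.norm_of_nonneg hn.le]
    · intro x hx y hy
      rw [add_sub_add_comm, ← smul_sub, inner_add_left, inner_smul_left,
        real_inner_self_eq_norm_sq]
      simpa using hmono x hx y hy
  choose x hxK hx using hreg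
  obtain ⟨z, hz, φ, hφ, hlim⟩ := hK.tendsto_subseq hxK
  refine ⟨z, hz, fun y hy => ?_⟩
  have hFc : ContinuousOn F K := by
    refine (LipschitzOnWith.of_dist_le_mul (K := L.toNNReal) fun x hx y hy => ?_).continuousOn
    rw [dist_eq_norm, dist_eq_norm]
    exact (hlip x hx y hy).trans (by gcongr; exact Real.le_coe_toNNReal L)
  have hF : Tendsto (fun n => F (x (φ n))) atTop (𝓝 (F z)) :=
    (hFc z hz).tendsto.comp
      (tendsto_nhdsWithin_iff.2 ⟨hlim, Eventually.of_forall fun n => hxK _⟩)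
  have h0 : Tendsto (fun n => (1 / ((φ n : ℝ) + 1))) atTop (𝓝 0) :=
    tendsto_one_div_add_atTop_nhds_zero_nat.comp hφ.tendsto_atTop
  have h1 := (hF.add (h0.smul hlim)).inner (tendsto_const_nhds (x := y) |>.sub hlim) (𝕜 := ℝ)
  rw [zero_smul, add_zero] at h1
  exact ge_of_tendsto' h1 fun n => hx (φ n) y hy

/-! ### Symmetries and moments of the uniform distribution on the sphere -/

open scoped Pointwise in
/-- The uniform distribution on the sphere is invariant under linear isometries. -/
theorem map_unifSphere {d : ℕ}
    (L : EuclideanSpace ℝ (Fin d) ≃ₗᵢ[ℝ] EuclideanSpace ℝ (Fin d)) :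
    (unifSphere d).map L = unifSphere d := by
  ext s hs
  have hL : Measurable L := L.continuous.measurable
  -- The surface measure of a set is, up to a constant, the volume of the cone over it, so
  -- invariance reduces to that of volume.
  have key : ∀ t : Set (EuclideanSpace ℝ (Fin d)), MeasurableSet t →
      (volume : Measure (EuclideanSpace ℝ (Fin d))).toSphere
        ((Subtype.val : Metric.sphere (0 : EuclideanSpace ℝ (Fin d)) 1 → _) ⁻¹' t) =
      Module.finrank ℝ (EuclideanSpace ℝ (Fin d)) *
        volume (Set.Ioo (0 : ℝ) 1 • (Metric.sphere (0 : EuclideanSpace ℝ (Fin d)) 1 ∩ t)) := by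
    intro t ht
    rw [Measure.toSphere_apply' _ (measurable_subtype_coe ht), Subtype.image_preimage_coe]
  rw [Measure.map_apply hL hs, unifSphere, Measure.map_apply measurable_subtype_coe hs,
    Measure.map_apply measurable_subtype_coe (hL hs), Measure.smul_apply, Measure.smul_apply,
    key s hs, key _ (hL hs)]
  congr 2
  have hset : Set.Ioo (0 : ℝ) 1 • (Metric.sphere (0 : EuclideanSpace ℝ (Fin d)) 1 ∩ L ⁻¹' s)
      = L ⁻¹' (Set.Ioo (0 : ℝ) 1 • (Metric.sphere (0 : EuclideanSpace ℝ (Fin d)) 1 ∩ s)) := by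
    ext x
    simp only [Set.mem_smul, Set.mem_preimage, Set.mem_inter_iff, mem_sphere_zero_iff_norm]
    constructor
    · rintro ⟨a, ha, y, ⟨hy, hys⟩, rfl⟩
      exact ⟨a, ha, L y, ⟨by simpa using hy, hys⟩, by simp⟩
    · rintro ⟨a, ha, y, ⟨hy, hys⟩, hxy⟩
      refine ⟨a, ha, L.symm y, ⟨by simpa using hy, by simpa using hys⟩, ?_⟩
      rw [← map_smul, hxy, L.symm_apply_apply]
  rw [hset]
  exact (L.measurePreserving.measure_preimage_equiv (f := L.toMeasurableEquiv) _)

theorem integral_unifSphere_comp {d : ℕ}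
    (L : EuclideanSpace ℝ (Fin d) ≃ₗᵢ[ℝ] EuclideanSpace ℝ (Fin d))
    (f : EuclideanSpace ℝ (Fin d) → ℝ) :
    ∫ x, f (L x) ∂unifSphere d = ∫ x, f x ∂unifSphere d := by
  conv_rhs => rw [← map_unifSphere L]
  exact (integral_map_equiv L.toMeasurableEquiv f).symm

theorem ae_unifSphere_norm_eq_one {d : ℕ} : ∀ᵐ x ∂unifSphere d, ‖x‖ = 1 := by
  rw [unifSphere, ae_map_iff measurable_subtype_coe.aemeasurable
    (measurableSet_eq_fun (by fun_prop) (by fun_prop))]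
  exact Eventually.of_forall fun x => mem_sphere_zero_iff_norm.1 x.2

/-- Coordinates are centered under the uniform distribution on the sphere. -/
theorem integral_unifSphere_coord {d : ℕ} (j : Fin d) : ∫ x, x j ∂unifSphere d = 0 := by
  have h := integral_unifSphere_comp (LinearIsometryEquiv.neg ℝ) (fun x => x j)
  simp [integral_neg] at h
  linarith

/-- The covariance of the uniform distribution on the sphere is `d⁻¹` times the identity. -/
theorem integral_unifSphere_coord_mul {d : ℕ} [IsProbabilityMeasure (unifSphere d)]
    (j l : Fin d) :
    (d : ℝ) * ∫ x, x j * x l ∂unifSphere d = if j = l then 1 else 0 := by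
  split_ifs with hjl
  · subst hjl
    -- Exchanging two coordinates shows that all second moments agree; they add up to `1` on the
    -- sphere.
    have heq : ∀ k, ∫ x, x k * x k ∂unifSphere d = ∫ x, x j * x j ∂unifSphere d := by
      intro k
      have h := integral_unifSphere_comp
        (LinearIsometryEquiv.piLpCongrLeft 2 ℝ ℝ (Equiv.swap j k)) (fun x => x j * x j)
      simpa [LinearIsometryEquiv.piLpCongrLeft_apply, Equiv.piCongrLeft'] using h
    have hint : ∀ k : Fin d, Integrable (fun x => x k * x k) (unifSphere d) := fun k => by
      refine Integrable.of_bound (C := 1) (by fun_prop) ?_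
      filter_upwards [ae_unifSphere_norm_eq_one] with x hx
      have h1 := PiLp.norm_apply_le x k
      rw [hx] at h1
      rw [norm_mul]
      nlinarith [norm_nonneg (x k)]
    have hsum : ∑ k, ∫ x, x k * x k ∂unifSphere d = 1 := by
      rw [← integral_finsetSum _ fun k _ => hint k]
      have : ∫ x, ∑ k, x k * x k ∂unifSphere d = ∫ x, (1 : ℝ) ∂unifSphere d := by
        refine integral_congr_ae ?_
        filter_upwards [ae_unifSphere_norm_eq_one] with x hx
        have h := EuclideanSpace.real_norm_sq_eq x
        rw [hx] at h
        simp only [← sq]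
        linarith
      rw [this]; simp
    simp_rw [heq] at hsum
    simpa using hsum
  -- Flipping the sign of the `j`-th coordinate alone negates the mixed moment.
  · have h := integral_unifSphere_comp
      (LinearIsometryEquiv.piLpCongrRight 2
        (fun k => if k = j then LinearIsometryEquiv.neg ℝ else LinearIsometryEquiv.refl ℝ ℝ))
      (fun x : EuclideanSpace ℝ (Fin d) => x j * x l)
    have hlj : l ≠ j := fun h => hjl h.symm
    simp [LinearIsometryEquiv.piLpCongrRight_apply, hlj, integral_neg] at h
    have : ∫ x, x j * x l ∂unifSphere d = 0 := by linarith
    rw [this, mul_zero]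

/-! ### Euclidean projections -/

section Projection

variable {d : ℕ} {A : Set (EuclideanSpace ℝ (Fin d))}

theorem projOn_spec (hA : IsClosed A) (hconv : Convex ℝ A) (hne : A.Nonempty)
    (y : EuclideanSpace ℝ (Fin d)) :
    projOn A y ∈ A ∧ ∀ z ∈ A, inner ℝ (y - projOn A y) (z - projOn A y) ≤ 0 := by
  have : Nonempty A := hne.to_subtype
  have hbdd : BddBelow (Set.range fun w : A => ‖y - w‖) :=
    ⟨0, by rintro _ ⟨w, rfl⟩; exact norm_nonneg _⟩
  have hex : ∃ x, x ∈ A ∧ ∀ z ∈ A, ‖y - x‖ ≤ ‖y - z‖ := by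
    obtain ⟨v, hv, hmin⟩ := exists_norm_eq_iInf_of_complete_convex hne hA.isComplete hconv y
    exact ⟨v, hv, fun z hz => hmin ▸ ciInf_le hbdd ⟨z, hz⟩⟩
  obtain ⟨hmem, hle⟩ := Classical.epsilon_spec hex
  refine ⟨hmem, (norm_eq_iInf_iff_real_inner_le_zero hconv hmem).1 (le_antisymm ?_ ?_)⟩
  · exact le_ciInf fun w => hle w w.2
  · exact ciInf_le hbdd ⟨_, hmem⟩

theorem projOn_of_mem (hA : IsClosed A) (hconv : Convex ℝ A) {y : EuclideanSpace ℝ (Fin d)}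
    (hy : y ∈ A) : projOn A y = y := by
  have h := (projOn_spec hA hconv ⟨y, hy⟩ y).2 y hy
  rw [real_inner_self_eq_norm_sq] at h
  have : ‖y - projOn A y‖ = 0 := by nlinarith [norm_nonneg (y - projOn A y)]
  exact (sub_eq_zero.1 (norm_eq_zero.1 this)).symm

theorem norm_projOn_sub_projOn_le (hA : IsClosed A) (hconv : Convex ℝ A) (hne : A.Nonempty)
    (x y : EuclideanSpace ℝ (Fin d)) : ‖projOn A x - projOn A y‖ ≤ ‖x - y‖ :=
  norm_sub_le_of_obtuse ((projOn_spec hA hconv hne x).2 _ (projOn_spec hA hconv hne y).1)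
    ((projOn_spec hA hconv hne y).2 _ (projOn_spec hA hconv hne x).1)

theorem continuous_projOn (hA : IsClosed A) (hconv : Convex ℝ A) (hne : A.Nonempty) :
    Continuous (projOn A) :=
  (LipschitzWith.of_dist_le_mul (K := 1) fun x y => by
    simpa [dist_eq_norm] using norm_projOn_sub_projOn_le hA hconv hne x y).continuous

end Projection

/-! ### First-order calculus of the game and its Nash equilibrium -/

theorem profileNorm_le_sum {N : ℕ} {d : Fin N → ℕ} (x : ∀ i, EuclideanSpace ℝ (Fin (d i))) :
    profileNorm x ≤ ∑ i, ‖x i‖ :=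
  Real.sqrt_le_iff.2 ⟨Finset.sum_nonneg fun _ _ => norm_nonneg _,
    Finset.sum_sq_le_sq_sum_of_nonneg fun _ _ => norm_nonneg _⟩

theorem profileNorm_nonneg {N : ℕ} {d : Fin N → ℕ} (x : ∀ i, EuclideanSpace ℝ (Fin (d i))) :
    0 ≤ profileNorm x := Real.sqrt_nonneg _

theorem continuous_profileNorm {N : ℕ} {d : Fin N → ℕ} :
    Continuous (profileNorm (d := d)) := by
  unfold profileNorm; fun_prop

namespace Game

variable {N : ℕ} {G : Game N}

theorem update_mem_profiles {a : G.Profile} (ha : a ∈ G.profiles) {i : Fin N}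
    {x : EuclideanSpace ℝ (Fin (G.dim i))} (hx : x ∈ G.act i) :
    Function.update a i x ∈ G.profiles := by
  intro j
  rcases eq_or_ne j i with rfl | h
  · simpa using hx
  · simpa [h] using ha j

namespace Regular

variable (hG : G.Regular)
include hG

theorem act_nonempty (i : Fin N) : (G.act i).Nonempty :=
  (hG.interior_nonempty i).mono interior_subset

theorem isCompact_profiles : IsCompact G.profiles := by
  have : G.profiles = Set.univ.pi G.act := by ext; simp [profiles]
  rw [this]
  exact isCompact_univ_pi hG.compact

theorem hasFDerivWithinAt_util (i : Fin N) {a : G.Profile} (ha : a ∈ G.profiles)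
    {x : EuclideanSpace ℝ (Fin (G.dim i))} (hx : x ∈ G.act i) :
    HasFDerivWithinAt (fun y => G.util i (Function.update a i y))
      (InnerProductSpace.toDual ℝ _ (G.grad i (Function.update a i x))) (G.act i) x := by
  have h := ((hG.util_contDiff i a ha).differentiableOn one_ne_zero) x hx
  have h2 := h.hasGradientWithinAt.hasFDerivWithinAt
  simpa [grad] using h2

/-- Uniform first-order expansion of a utility in the player's own action. -/
theorem exists_taylor (i : Fin N) : ∃ L, 0 ≤ L ∧
    (∀ a ∈ G.profiles, ∀ b ∈ G.profiles, ‖G.grad i a - G.grad i b‖ ≤ L * profileNorm (a - b)) ∧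
    ∀ a ∈ G.profiles, ∀ y ∈ G.act i,
      |G.util i (Function.update a i y) - G.util i a - inner ℝ (G.grad i a) (y - a i)|
        ≤ L * ‖y - a i‖ ^ 2 := by
  obtain ⟨L, hL⟩ := hG.grad_lipschitz i
  have hL' : ∀ a ∈ G.profiles, ∀ b ∈ G.profiles,
      ‖G.grad i a - G.grad i b‖ ≤ |L| * profileNorm (a - b) := fun a ha b hb =>
    (hL a ha b hb).trans (mul_le_mul_of_nonneg_right (le_abs_self L) (profileNorm_nonneg _))
  refine ⟨|L|, abs_nonneg L, hL', fun a ha y hy => ?_⟩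
  have hseg : segment ℝ (a i) y ⊆ G.act i := (hG.convex i).segment_subset (ha i) hy
  have hbound : ∀ x ∈ segment ℝ (a i) y,
      ‖InnerProductSpace.toDual ℝ _ (G.grad i (Function.update a i x))
        - InnerProductSpace.toDual ℝ _ (G.grad i a)‖ ≤ |L| * ‖y - a i‖ := by
    intro x hx
    rw [← map_sub, LinearIsometryEquiv.norm_map]
    refine (hL' _ (update_mem_profiles ha (hseg hx)) a ha).trans ?_
    gcongr
    refine (profileNorm_le_sum _).trans ?_
    rw [Finset.sum_eq_single i]
    · rw [Pi.sub_apply, Function.update_self]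
      exact norm_sub_le_of_mem_segment hx
    · intro j _ hj; simp [hj]
    · simp
  have h := Convex.norm_image_sub_le_of_norm_hasFDerivWithin_le'
    (fun x hx => (hG.hasFDerivWithinAt_util i ha (hseg hx)).mono hseg) hbound
    (convex_segment (a i) y) (left_mem_segment ℝ _ _) (right_mem_segment ℝ _ _)
  simpa [Real.norm_eq_abs, InnerProductSpace.toDual_apply_apply, sq, mul_assoc] using h

theorem continuousOn_grad (i : Fin N) : ContinuousOn (G.grad i) G.profiles := by
  obtain ⟨L, -, hL, -⟩ := hG.exists_taylor i
  intro a ha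
  rw [ContinuousWithinAt, tendsto_iff_norm_sub_tendsto_zero]
  have h0 : Tendsto (fun b => L * profileNorm (b - a)) (𝓝[G.profiles] a) (𝓝 0) := by
    have hc : Continuous fun b : G.Profile => L * profileNorm (b - a) :=
      continuous_const.mul (continuous_profileNorm.comp (continuous_id.sub continuous_const))
    have := (hc.tendsto a).mono_left (nhdsWithin_le_nhds (s := G.profiles))
    simpa [profileNorm] using this
  refine squeeze_zero' (Eventually.of_forall fun _ => norm_nonneg _) ?_ h0
  filter_upwards [self_mem_nhdsWithin] with b hb using hL b hb a ha

/-- Uniform bounds for actions, utilities and gradients. -/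
theorem exists_bound : ∃ M, 0 < M ∧ ∀ i, ∀ a ∈ G.profiles,
    ‖a i‖ ≤ M ∧ |G.util i a| ≤ M ∧ ‖G.grad i a‖ ≤ M := by
  have h1 : ∀ i, ∃ C, 0 ≤ C ∧ ∀ a ∈ G.profiles, ‖a i‖ ≤ C ∧ |G.util i a| ≤ C ∧ ‖G.grad i a‖ ≤ C := by
    intro i
    obtain ⟨C₁, h₁⟩ := (hG.compact i).exists_bound_of_continuousOn continuousOn_id
    obtain ⟨C₂, h₂⟩ := hG.isCompact_profiles.exists_bound_of_continuousOn (hG.util_continuous i)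
    obtain ⟨C₃, h₃⟩ := hG.isCompact_profiles.exists_bound_of_continuousOn (hG.continuousOn_grad i)
    refine ⟨|C₁| + |C₂| + |C₃|, by positivity, fun a ha => ⟨?_, ?_, ?_⟩⟩
    · have := h₁ _ (ha i)
      have := le_abs_self C₁
      simp only [id] at *
      linarith [abs_nonneg C₂, abs_nonneg C₃]
    · have := h₂ _ ha
      have := le_abs_self C₂
      rw [Real.norm_eq_abs] at *
      linarith [abs_nonneg C₁, abs_nonneg C₃]
    · have := h₃ _ ha
      have := le_abs_self C₃
      linarith [abs_nonneg C₁, abs_nonneg C₂]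
  choose C hC0 hC using h1
  refine ⟨1 + ∑ i, C i, by have := Finset.sum_nonneg fun i (_ : i ∈ Finset.univ) => hC0 i; linarith,
    fun i a ha => ?_⟩
  have h2 : C i ≤ 1 + ∑ i, C i := by
    have := Finset.single_le_sum (fun i _ => hC0 i) (Finset.mem_univ i)
    linarith
  obtain ⟨h3, h4, h5⟩ := hC i a ha
  exact ⟨h3.trans h2, h4.trans h2, h5.trans h2⟩

/-- Nash equilibria are the solutions of the variational inequality of the gradient field. -/
theorem isNash_iff {a : G.Profile} : G.IsNash a ↔
    a ∈ G.profiles ∧ ∀ i, ∀ x ∈ G.act i, inner ℝ (G.grad i a) (x - a i) ≤ 0 := by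
  refine and_congr_right fun ha => forall_congr' fun i => ⟨fun h x hx => ?_, fun h x hx => ?_⟩
  · have hmax : IsLocalMaxOn (fun y => G.util i (Function.update a i y)) (G.act i) (a i) := by
      refine IsMaxOn.localize fun y hy => ?_
      simpa using h y hy
    have h1 := hmax.hasFDerivWithinAt_nonpos (hG.hasFDerivWithinAt_util i ha (ha i))
      (sub_mem_posTangentConeAt_of_segment_subset ((hG.convex i).segment_subset (ha i) hx))
    simpa [InnerProductSpace.toDual_apply_apply] using h1
  · obtain ⟨L, hL0, -, hL⟩ := hG.exists_taylor i
    -- By concavity the gain at `x` is at most `t⁻¹` times the gain at `a + t (x - a)`. The linear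
    -- part of the latter is nonpositive, so only the quadratic remainder survives, and `t` tends to
    -- `0`.
    have key : ∀ t : ℝ, 0 < t → t ≤ 1 →
        G.util i (Function.update a i x) - G.util i a ≤ t * (L * ‖x - a i‖ ^ 2) := by
      intro t ht ht1
      set y := (1 - t) • a i + t • x with hy
      have hym : y ∈ G.act i := hG.convex i (ha i) hx (by linarith) ht.le (by ring)
      have h1 := (hG.util_concave i a ha).2 (ha i) hx (sub_nonneg.2 ht1) ht.le (by ring)
      have h2 := (abs_le.1 (hL a ha y hym)).2
      have hya : y - a i = t • (x - a i) := by rw [hy, sub_smul, one_smul, smul_sub]; abel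
      rw [hya, inner_smul_right, norm_smul, Real.norm_of_nonneg ht.le, mul_pow] at h2
      simp only [Function.update_eq_self, smul_eq_mul] at h1
      have h3 := mul_nonpos_of_nonneg_of_nonpos ht.le (h x hx)
      rw [← hy] at h1
      refine le_of_mul_le_mul_left ?_ ht
      nlinarith
    have hlim : Tendsto (fun t : ℝ => t * (L * ‖x - a i‖ ^ 2)) (𝓝[>] 0) (𝓝 0) := by
      have : Tendsto (fun t : ℝ => t * (L * ‖x - a i‖ ^ 2)) (𝓝 0) (𝓝 (0 * (L * ‖x - a i‖ ^ 2))) :=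
        tendsto_id.mul_const _
      rw [zero_mul] at this
      exact this.mono_left nhdsWithin_le_nhds
    have := ge_of_tendsto hlim (by
      filter_upwards [Ioc_mem_nhdsGT (zero_lt_one' ℝ)] with t ht using key t ht.1 ht.2)
    linarith

/-- The negated pseudo-gradient is a monotone Lipschitz field once profiles are placed in the L²
product, since the plain product carries the sup norm and no inner product. -/
theorem exists_isNash (hmono : G.StrictlyMonotone) : ∃ a, G.IsNash a := by
  let H := PiLp 2 (fun i => EuclideanSpace ℝ (Fin (G.dim i)))
  let K : Set H := {x | WithLp.ofLp x ∈ G.profiles}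
  let F : H → H := fun x => WithLp.toLp 2 fun i => - G.grad i (WithLp.ofLp x)
  have hnorm : ∀ x : H, ‖x‖ = profileNorm (WithLp.ofLp x) := fun x => by
    rw [PiLp.norm_eq_of_L2]; rfl
  have hK : IsCompact K :=
    (PiLp.homeomorph 2 (fun i => EuclideanSpace ℝ (Fin (G.dim i)))).isCompact_preimage.2
      hG.isCompact_profiles
  have hconv : Convex ℝ K := by
    intro x hx y hy s t hs ht hst i
    exact hG.convex i (hx i) (hy i) hs ht hst
  have hne : K.Nonempty := by
    choose z hz using hG.act_nonempty
    exact ⟨WithLp.toLp 2 z, hz⟩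
  choose L hL0 hL _ using hG.exists_taylor
  obtain ⟨x, hx, hvi⟩ := exists_monotone_vi hK hconv hne (F := F) (L := ∑ i, L i) (by
      intro x hx y hy
      rw [hnorm, hnorm (x - y), Finset.sum_mul]
      refine (profileNorm_le_sum _).trans (Finset.sum_le_sum fun i _ => ?_)
      change ‖- G.grad i (WithLp.ofLp x) - - G.grad i (WithLp.ofLp y)‖ ≤ _
      rw [neg_sub_neg, norm_sub_rev]
      exact hL i _ hx _ hy) (by
      intro x hx y hy
      rw [PiLp.inner_apply]
      by_cases hxy : x = y
      · simp [hxy]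
      have h := hmono _ hx _ hy (fun h => hxy (WithLp.ofLp_injective 2 h))
      have h2 : ∑ i, inner ℝ ((F x - F y) i) ((x - y) i) = - ∑ i, inner ℝ
          (G.grad i (WithLp.ofLp x) - G.grad i (WithLp.ofLp y))
          (WithLp.ofLp x i - WithLp.ofLp y i) := by
        rw [← Finset.sum_neg_distrib]
        refine Finset.sum_congr rfl fun i _ => ?_
        change inner ℝ (- G.grad i (WithLp.ofLp x) - - G.grad i (WithLp.ofLp y)) _ = _
        rw [neg_sub_neg, ← neg_sub, inner_neg_left]
        rfl
      rw [h2]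
      linarith)
  refine ⟨WithLp.ofLp x, hG.isNash_iff.2 ⟨hx, fun i z hz => ?_⟩⟩
  -- Testing with unilateral deviations separates the joint inequality into one for each player.
  have h := hvi (WithLp.toLp 2 (Function.update (WithLp.ofLp x) i z)) (update_mem_profiles hx hz)
  rw [PiLp.inner_apply, Finset.sum_eq_single i] at h
  · change 0 ≤ inner ℝ (- G.grad i (WithLp.ofLp x))
      (Function.update (WithLp.ofLp x) i z i - WithLp.ofLp x i) at h
    rw [Function.update_self, inner_neg_left] at h
    linarith
  · intro j _ hj
    change inner ℝ _ (Function.update (WithLp.ofLp x) i z j - WithLp.ofLp x j) = 0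
    simp [hj]
  · simp

/-- The pseudo-gradient points strictly towards the Nash equilibrium. -/
theorem sum_inner_grad_neg (hmono : G.StrictlyMonotone) {a b : G.Profile} (ha : G.IsNash a)
    (hb : b ∈ G.profiles) (hne : b ≠ a) :
    ∑ i, inner ℝ (G.grad i b) (b i - a i) < 0 := by
  have h1 := hmono b hb a ha.1 hne
  have h2 : ∑ i, inner ℝ (G.grad i a) (b i - a i) ≤ 0 :=
    Finset.sum_nonpos fun i _ => (hG.isNash_iff.1 ha).2 i _ (hb i)
  simp only [inner_sub_left, Finset.sum_sub_distrib] at h1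
  linarith

/-- Monotonicity against the equilibrium `a` makes `∑ ⟨gᵢ(b), bᵢ - aᵢ⟩` negative, while the
first-order condition at `b` makes it nonnegative. -/
theorem isNash_unique (hmono : G.StrictlyMonotone) {a b : G.Profile} (ha : G.IsNash a)
    (hb : G.IsNash b) : b = a := by
  by_contra hne
  have h1 := hG.sum_inner_grad_neg hmono ha hb.1 hne
  have h2 := hG.sum_inner_grad_neg hmono hb ha.1 (Ne.symm hne)
  have h3 := hmono b hb.1 a ha.1 hne
  have h4 : ∑ i, inner ℝ (G.grad i b) (a i - b i) ≤ 0 :=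
    Finset.sum_nonpos fun i _ => (hG.isNash_iff.1 hb).2 i _ (ha.1 i)
  have h5 : ∑ i, inner ℝ (G.grad i b) (a i - b i) = - ∑ i, inner ℝ (G.grad i b) (b i - a i) := by
    rw [← Finset.sum_neg_distrib]
    exact Finset.sum_congr rfl fun i _ => by rw [← neg_sub, inner_neg_right]
  linarith

end Regular
end Game

/-! ### The algorithm along a sample path -/

/-- The `0`-`1` value of a feedback indicator. -/
def feedbackVal (x : Bool) : ℝ := if x = true then 1 else 0

/-- A predictable version of the step size, truncated by means of the feedback probability. -/
noncomputable def truncStep (q p : ℝ) (J : ℕ → Bool) (n : ℕ) : ℝ :=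
  (max (∑ t ∈ Finset.range n, feedbackVal (J t) + 1) (p * ((n : ℝ) + 1) / 2)) ^ (-q)

/-- When feedback arrives, the count including the current stage is the earlier count plus one, so
the step is a function of the past. -/
theorem stepSize_eq_truncStep {q p : ℝ} {J : ℕ → Bool} {n : ℕ} (hJ : J n = true)
    (hn : p * ((n : ℝ) + 1) / 2 ≤ ∑ t ∈ Finset.range n, feedbackVal (J t) + 1) :
    stepSize q J n = truncStep q p J n := by
  have h : ((feedbackCount J n : ℕ) : ℝ) = ∑ t ∈ Finset.range n, feedbackVal (J t) + 1 := by
    rw [feedbackCount, Finset.sum_range_succ, if_pos hJ]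
    push_cast
    rfl
  have h0 : 0 ≤ ∑ t ∈ Finset.range n, feedbackVal (J t) + 1 := by rw [← h]; positivity
  rw [stepSize, truncStep, max_eq_left hn, h, Real.rpow_neg h0, one_div]

theorem truncStep_nonneg {q p : ℝ} {J : ℕ → Bool} {n : ℕ} (hp : 0 < p) :
    0 ≤ truncStep q p J n :=
  Real.rpow_nonneg (le_max_of_le_right (by positivity)) _

theorem truncStep_le {q p : ℝ} {J : ℕ → Bool} {n : ℕ} (hp : 0 < p) (hq : 0 ≤ q) :
    truncStep q p J n ≤ (p / 2) ^ (-q) * ((n : ℝ) + 1) ^ (-q) := by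
  rw [← Real.mul_rpow (by positivity) (by positivity), truncStep]
  refine Real.rpow_le_rpow_of_nonpos (by positivity) (le_max_of_le_right (le_of_eq ?_)) (by linarith)
  ring

/-- Comparison of the truncated step with its deterministic equivalent. -/
theorem abs_truncStep_sub_le {q p : ℝ} {J : ℕ → Bool} {n : ℕ} (hp : 0 < p) (hq : 0 ≤ q) :
    |p ^ (q - 1) * (p * truncStep q p J n) - ((n : ℝ) + 1) ^ (-q)| ≤
      q * (1 / 2) ^ (-q - 1) * p⁻¹ * (((n : ℝ) + 1) ^ (-q - 1) *
        |∑ t ∈ Finset.range n, feedbackVal (J t) + 1 - p * ((n : ℝ) + 1)|) := by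
  set m : ℝ := (n : ℝ) + 1
  have hm : 0 < m := by positivity
  set Γ : ℝ := ∑ t ∈ Finset.range n, feedbackVal (J t) + 1
  -- The quotient `y` estimates the stage number `m`. The prefactor is chosen so that the weighted
  -- step is exactly `y ^ (-q)`, and truncation keeps `y ≥ m / 2`, where the mean value inequality
  -- applies.
  set y : ℝ := max Γ (p * m / 2) / p with hy
  have hmax : p * m / 2 ≤ max Γ (p * m / 2) := le_max_right _ _
  have hym : 1 / 2 * m ≤ y := by rw [hy, le_div_iff₀ hp]; linarith
  have h1 : p ^ (q - 1) * (p * truncStep q p J n) = y ^ (-q) := by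
    rw [hy, Real.div_rpow (by positivity) hp.le, truncStep, ← mul_assoc,
      ← Real.rpow_add_one hp.ne', Real.rpow_neg hp.le q, div_inv_eq_mul, sub_add_cancel, mul_comm]
  have h2 : |y ^ (-q) - m ^ (-q)| ≤ q * (1 / 2 * m) ^ (-q - 1) * |y - m| := by
    have h := Convex.norm_image_sub_le_of_norm_hasDerivWithin_le (𝕜 := ℝ)
      (f := fun t : ℝ => t ^ (-q)) (f' := fun t => -q * t ^ (-q - 1))
      (s := Set.Ici (1 / 2 * m)) (C := q * (1 / 2 * m) ^ (-q - 1)) (x := m) (y := y)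
      (fun t ht => (Real.hasDerivAt_rpow_const
        (Or.inl (lt_of_lt_of_le (by positivity) (Set.mem_Ici.1 ht)).ne')).hasDerivWithinAt)
      (fun t ht => by
        have ht' : 0 < t := lt_of_lt_of_le (by positivity) (Set.mem_Ici.1 ht)
        rw [norm_mul, norm_neg, Real.norm_of_nonneg hq,
          Real.norm_of_nonneg (Real.rpow_nonneg ht'.le _)]
        exact mul_le_mul_of_nonneg_left
          (Real.rpow_le_rpow_of_nonpos (by positivity) (Set.mem_Ici.1 ht) (by linarith)) hq)
      (convex_Ici _) (Set.mem_Ici.2 (by linarith)) hym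
    simpa using h
  have h3 : |y - m| ≤ p⁻¹ * |Γ - p * m| := by
    have : y - m = p⁻¹ * (max Γ (p * m / 2) - p * m) := by rw [hy]; field_simp
    rw [this, abs_mul, abs_of_pos (inv_pos.2 hp)]
    refine mul_le_mul_of_nonneg_left ?_ (inv_pos.2 hp).le
    have hpm : max (p * m) (p * m / 2) = p * m := max_eq_left (by nlinarith [mul_pos hp hm])
    calc |max Γ (p * m / 2) - p * m|
        = |max Γ (p * m / 2) - max (p * m) (p * m / 2)| := by rw [hpm]
      _ ≤ |Γ - p * m| := abs_max_sub_max_le_abs _ _ _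
  rw [h1]
  refine h2.trans ?_
  rw [Real.mul_rpow (by norm_num) hm.le]
  have h4 : 0 ≤ q * ((1 / 2 : ℝ) ^ (-q - 1) * m ^ (-q - 1)) := by positivity
  refine (mul_le_mul_of_nonneg_left h3 h4).trans (le_of_eq (by ring))

/-! ### Exploration and the one-step inequality -/

namespace Game

variable {N : ℕ} {G : Game N}

/-- The applied action is the convex combination of `a i` and the point `c i + r i • l i` of the
safety ball, with weight `δ / r i` on the latter. -/
theorem perturb_mem (hconv : ∀ i, Convex ℝ (G.act i)) {c : G.Profile} {r : Fin N → ℝ}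
    (hr : ∀ i, 0 < r i) (hball : ∀ i, Metric.closedBall (c i) (r i) ⊆ G.act i) {δ : ℝ}
    (hδ : 0 ≤ δ) (hδr : ∀ i, δ ≤ r i) {a l : G.Profile} (ha : a ∈ G.profiles)
    (hl : ∀ i, ‖l i‖ ≤ 1) : G.perturb c r δ a l ∈ G.profiles := by
  intro i
  have hri := hr i
  have h1 : c i + r i • l i ∈ G.act i := hball i (by
    rw [mem_closedBall_iff_norm, add_sub_cancel_left, norm_smul, Real.norm_of_nonneg hri.le]
    nlinarith [hl i])
  have h2 : δ / r i ≤ 1 := (div_le_one hri).2 (hδr i)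
  have h3 := hconv i (ha i) h1 (sub_nonneg.2 h2) (div_nonneg hδ hri.le) (sub_add_cancel _ _)
  convert h3 using 1
  simp only [perturb, smul_sub, smul_add, sub_smul, one_smul, smul_smul]
  rw [div_mul_cancel₀ _ hri.ne', ← div_eq_mul_inv]
  abel

theorem norm_perturb_sub_le {c : G.Profile} {r : Fin N → ℝ} {δ : ℝ} (hδ : 0 ≤ δ)
    {a l : G.Profile} {i : Fin N} (hl : ‖l i‖ ≤ 1) :
    ‖G.perturb c r δ a l i - a i‖ ≤ δ * (1 + |(r i)⁻¹| * ‖a i - c i‖) := by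
  rw [perturb, add_sub_cancel_left, norm_smul, Real.norm_of_nonneg hδ]
  gcongr
  refine (norm_sub_le _ _).trans ?_
  rw [norm_smul, Real.norm_eq_abs]
  gcongr

/-- Isolates the player's own direction: the base profile keeps the pull towards the centre and the
exploration of the others, so its value is independent of `l i`. -/
theorem perturb_eq_update (c : G.Profile) (r : Fin N → ℝ) (δ : ℝ) (a l : G.Profile) (i : Fin N) :
    G.perturb c r δ a l = Function.update (G.perturb c r δ a (Function.update l i 0)) i
      (G.perturb c r δ a (Function.update l i 0) i + δ • l i) := by
  funext j
  rcases eq_or_ne j i with rfl | h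
  · simp only [perturb, Function.update_self, smul_sub]
    simp
    abel
  · simp [perturb, h]

/-- Expansion of the value seen by a player around the profile in which that player does not
explore. -/
theorem Regular.exists_expansion (hG : G.Regular) {c : G.Profile} {r : Fin N → ℝ}
    (hr : ∀ i, 0 < r i) (hball : ∀ i, Metric.closedBall (c i) (r i) ⊆ G.act i) (i : Fin N) :
    ∃ C, 0 ≤ C ∧ ∀ δ, 0 ≤ δ → (∀ j, δ ≤ r j) → ∀ a ∈ G.profiles, ∀ l : G.Profile,
      (∀ j, ‖l j‖ ≤ 1) →
      |G.util i (G.perturb c r δ a l) - G.util i (G.perturb c r δ a (Function.update l i 0))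
        - δ * inner ℝ (G.grad i a) (l i)| ≤ C * δ ^ 2 := by
  obtain ⟨L, hL0, hL, hT⟩ := hG.exists_taylor i
  obtain ⟨M, hM0, hM⟩ := hG.exists_bound
  have hc : c ∈ G.profiles := fun j => hball j (Metric.mem_closedBall_self (hr j).le)
  set Q : ℝ := ∑ j, (1 + |(r j)⁻¹| * (2 * M))
  -- `L` is the Taylor remainder at the unexplored profile; `L * Q` is the cost of moving the
  -- gradient from there to `a`, at distance at most `δ * Q`.
  refine ⟨L + L * Q, ?_, ?_⟩
  · have : 0 ≤ Q := Finset.sum_nonneg fun j _ => by positivity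
    positivity
  intro δ hδ hδr a ha l hl
  set l' := Function.update l i 0
  have hl' : ∀ j, ‖l' j‖ ≤ 1 := fun j => by
    rcases eq_or_ne j i with rfl | h
    · simp [l']
    · simpa [l', h] using hl j
  set b := G.perturb c r δ a l'
  have hb : b ∈ G.profiles := perturb_mem hG.convex hr hball hδ hδr ha hl'
  have hy : b i + δ • l i ∈ G.act i := by
    have h1 := perturb_mem hG.convex hr hball hδ hδr ha hl i
    rw [perturb_eq_update c r δ a l i, Function.update_self] at h1
    exact h1
  have h1 := hT b hb _ hy
  rw [← perturb_eq_update c r δ a l i, add_sub_cancel_left, norm_smul, Real.norm_of_nonneg hδ,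
    inner_smul_right] at h1
  have h2 : profileNorm (b - a) ≤ δ * Q := by
    refine (profileNorm_le_sum _).trans ?_
    rw [Finset.mul_sum]
    refine Finset.sum_le_sum fun j _ => ?_
    refine (norm_perturb_sub_le hδ (hl' j)).trans ?_
    gcongr
    exact (norm_sub_le _ _).trans (by linarith [(hM j a ha).1, (hM j c hc).1])
  have h3 : |inner ℝ (G.grad i b - G.grad i a) (l i)| ≤ L * (δ * Q) := by
    refine (abs_real_inner_le_norm _ _).trans ?_
    calc ‖G.grad i b - G.grad i a‖ * ‖l i‖ ≤ ‖G.grad i b - G.grad i a‖ * 1 := by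
          gcongr; exact hl i
      _ ≤ L * profileNorm (b - a) := by rw [mul_one]; exact hL b hb a ha
      _ ≤ _ := by gcongr
  have h4 : L * (δ * ‖l i‖) ^ 2 ≤ L * δ ^ 2 := by
    gcongr
    nlinarith [hl i, norm_nonneg (l i)]
  rw [inner_sub_left] at h3
  have h5 : |δ * (inner ℝ (G.grad i b) (l i) - inner ℝ (G.grad i a) (l i))| ≤ δ * (L * (δ * Q)) := by
    rw [abs_mul, abs_of_nonneg hδ]; gcongr
  have h6 := abs_add_le (G.util i (G.perturb c r δ a l) - G.util i b
    - δ * inner ℝ (G.grad i b) (l i))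
    (δ * (inner ℝ (G.grad i b) (l i) - inner ℝ (G.grad i a) (l i)))
  have h7 : G.util i (G.perturb c r δ a l) - G.util i b - δ * inner ℝ (G.grad i a) (l i)
      = (G.util i (G.perturb c r δ a l) - G.util i b - δ * inner ℝ (G.grad i b) (l i))
        + δ * (inner ℝ (G.grad i b) (l i) - inner ℝ (G.grad i a) (l i)) := by ring
  rw [h7]
  refine h6.trans ?_
  nlinarith

/-- Weight of the `j`-th coordinate of the direction in the noise caused by the values that
do not depend on player `i`'s own exploration. -/
noncomputable def valueWeight (G : Game N) (c : G.Profile) (r : Fin N → ℝ) (δ s : ℝ)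
    (a l : G.Profile) (x : Bool) (i : Fin N) (b : EuclideanSpace ℝ (Fin (G.dim i)))
    (j : Fin (G.dim i)) : ℝ :=
  s * feedbackVal x * ((G.dim i : ℝ) / δ) *
    G.util i (G.perturb c r δ a (Function.update l i 0)) * (a i j - b j)

/-- Weight of the fluctuation of `λⱼ λₖ` in the noise of the gradient estimate. -/
noncomputable def gradWeight (G : Game N) (s : ℝ) (a : G.Profile) (i : Fin N)
    (b : EuclideanSpace ℝ (Fin (G.dim i))) (j k : Fin (G.dim i)) : ℝ :=
  s * G.grad i a j * (a i k - b k)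

/-- Centered fluctuation of `d x λⱼ λₖ`. -/
noncomputable def covFluct {d : ℕ} (p : ℝ) (x : Bool) (l : EuclideanSpace ℝ (Fin d))
    (j k : Fin d) : ℝ :=
  d * (feedbackVal x * (l j * l k)) - if j = k then p else 0

theorem inner_eq_sum {d : ℕ} (x y : EuclideanSpace ℝ (Fin d)) :
    inner ℝ x y = ∑ j, x j * y j := by
  rw [PiLp.inner_apply]
  exact Finset.sum_congr rfl fun j _ => by simp [mul_comm]

/-- One step of the algorithm for one player. -/
theorem Regular.norm_step_sub_sq_le (hG : G.Regular) {c : G.Profile} {r : Fin N → ℝ}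
    (hr : ∀ i, 0 < r i) (hball : ∀ i, Metric.closedBall (c i) (r i) ⊆ G.act i) {i : Fin N}
    {C M : ℝ} (hM : ∀ i, ∀ a ∈ G.profiles, ‖a i‖ ≤ M ∧ |G.util i a| ≤ M ∧ ‖G.grad i a‖ ≤ M)
    {δ : ℝ} (hδ : 0 < δ) (hδr : ∀ j, δ ≤ r j) {a l : G.Profile} (ha : a ∈ G.profiles)
    (hl : ∀ j, ‖l j‖ ≤ 1)
    (hC : |G.util i (G.perturb c r δ a l) - G.util i (G.perturb c r δ a (Function.update l i 0))
        - δ * inner ℝ (G.grad i a) (l i)| ≤ C * δ ^ 2)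
    {b : EuclideanSpace ℝ (Fin (G.dim i))} (hb : b ∈ G.act i)
    {s : ℝ} (hs : 0 ≤ s) (p : ℝ) (x : Bool) :
    ‖(if x = true then projOn (G.act i) (a i + s • G.gradEst δ (G.perturb c r δ a l) l i)
        else a i) - b‖ ^ 2 ≤
      ‖a i - b‖ ^ 2 + 2 * (p * s * inner ℝ (G.grad i a) (a i - b))
      + 2 * ∑ j, valueWeight G c r δ s a l x i b j * l i j
      + 2 * ∑ j, ∑ k, gradWeight G s a i b j k * covFluct p x (l i) j k
      + 4 * G.dim i * C * M * (s * δ) + (G.dim i * M) ^ 2 * (s ^ 2 * (δ ^ 2)⁻¹) := by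
  have hsum1 : ∑ j, valueWeight G c r δ s a l x i b j * l i j =
      s * feedbackVal x * ((G.dim i : ℝ) / δ) *
        G.util i (G.perturb c r δ a (Function.update l i 0)) * inner ℝ (l i) (a i - b) := by
    rw [inner_eq_sum, Finset.mul_sum]
    refine Finset.sum_congr rfl fun j _ => ?_
    simp only [valueWeight, PiLp.sub_apply]; ring
  have hsum2 : ∑ j, ∑ k, gradWeight G s a i b j k * covFluct p x (l i) j k =
      s * feedbackVal x * G.dim i * inner ℝ (G.grad i a) (l i) * inner ℝ (l i) (a i - b)
        - p * s * inner ℝ (G.grad i a) (a i - b) := by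
    have h1 : ∀ j k, gradWeight G s a i b j k * covFluct p x (l i) j k =
        s * feedbackVal x * G.dim i * ((G.grad i a j * l i j) * (l i k * (a i k - b k)))
        - p * s * (if j = k then G.grad i a j * (a i k - b k) else 0) := by
      intro j k
      simp only [gradWeight, covFluct]
      split_ifs <;> ring
    simp only [h1, Finset.sum_sub_distrib, ← Finset.mul_sum, Finset.sum_ite_eq, Finset.mem_univ,
      if_true]
    rw [inner_eq_sum, inner_eq_sum, inner_eq_sum, ← Finset.sum_mul]
    simp only [PiLp.sub_apply]
    ring
  have hM0 : 0 ≤ M := (norm_nonneg _).trans (hM i a ha).1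
  have hC0 : 0 ≤ C := by
    by_contra! h
    have := (abs_nonneg _).trans hC
    nlinarith [pow_pos hδ 2]
  rw [hsum1, hsum2]
  cases x with
  -- Without feedback the value noise vanishes, and the centering constant in `covFluct` cancels the
  -- drift exactly.
  | false =>
    simp only [feedbackVal]
    norm_num
    have : 0 ≤ 4 * G.dim i * C * M * (s * δ) := by positivity
    have : 0 ≤ (G.dim i * M) ^ 2 * (s ^ 2 * (δ ^ 2)⁻¹) := by positivity
    linarith
  | true =>
    simp only [feedbackVal, if_true, mul_one]
    set u := G.util i (G.perturb c r δ a l)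
    set u₀ := G.util i (G.perturb c r δ a (Function.update l i 0))
    have hu : |u| ≤ M := (hM i _ (perturb_mem hG.convex hr hball hδ.le hδr ha hl)).2.1
    set v := G.gradEst δ (G.perturb c r δ a l) l i with hv
    have hvv : v = ((G.dim i : ℝ) / δ * u) • l i := rfl
    have h1 : ‖projOn (G.act i) (a i + s • v) - b‖ ^ 2 ≤ ‖(a i - b) + s • v‖ ^ 2 := by
      refine pow_le_pow_left₀ (norm_nonneg _) ?_ 2
      have h := norm_projOn_sub_projOn_le (hG.compact i).isClosed (hG.convex i)
        (hG.act_nonempty i) (a i + s • v) b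
      rwa [projOn_of_mem (hG.compact i).isClosed (hG.convex i) hb, add_sub_right_comm] at h
    rw [norm_add_sq_real, inner_smul_right, norm_smul, hvv, inner_smul_right, norm_smul,
      real_inner_comm, Real.norm_of_nonneg hs] at h1
    have h2 : ‖(G.dim i : ℝ) / δ * u‖ * ‖l i‖ ≤ G.dim i / δ * M := by
      rw [Real.norm_eq_abs, abs_mul, abs_of_nonneg (by positivity : (0 : ℝ) ≤ G.dim i / δ)]
      calc _ ≤ (G.dim i : ℝ) / δ * M * 1 := by gcongr; exact hl i
        _ = _ := mul_one _
    have h3 : (s * (‖(G.dim i : ℝ) / δ * u‖ * ‖l i‖)) ^ 2 ≤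
        (G.dim i * M) ^ 2 * (s ^ 2 * (δ ^ 2)⁻¹) := by
      calc _ ≤ (s * (G.dim i / δ * M)) ^ 2 := by gcongr
        _ = _ := by field_simp
    have hin : |inner ℝ (l i) (a i - b)| ≤ 2 * M := by
      refine (abs_real_inner_le_norm _ _).trans ?_
      have hb' : ‖b‖ ≤ M := by
        have := (hM i _ (update_mem_profiles ha hb)).1
        rwa [Function.update_self] at this
      have h4 : ‖a i - b‖ ≤ 2 * M := (norm_sub_le _ _).trans (by linarith [(hM i a ha).1])
      calc _ ≤ 1 * (2 * M) := by gcongr; exact hl i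
        _ = _ := one_mul _
    set z := inner ℝ (l i) (a i - b)
    set g := inner ℝ (G.grad i a) (l i)
    have h5 : s * ((G.dim i : ℝ) / δ * u * z) ≤ s * ((G.dim i : ℝ) / δ) * u₀ * z
        + s * G.dim i * g * z + 2 * G.dim i * C * M * (s * δ) := by
      -- The remainder of order `δ ^ 2`, multiplied by `d / δ`, leaves a bias of order `δ`.
      have h6 : |(u - u₀ - δ * g) * z| ≤ C * δ ^ 2 * (2 * M) := by
        rw [abs_mul]; exact mul_le_mul hC hin (abs_nonneg _) (by positivity)
      have h7 := mul_le_mul_of_nonneg_left (le_of_abs_le h6)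
        (by positivity : 0 ≤ s * ((G.dim i : ℝ) / δ))
      have h8 : s * ((G.dim i : ℝ) / δ) * ((u - u₀ - δ * g) * z) =
          s * ((G.dim i : ℝ) / δ * u * z) - s * ((G.dim i : ℝ) / δ) * u₀ * z
            - s * G.dim i * g * z := by field_simp
      have h9 : s * ((G.dim i : ℝ) / δ) * (C * δ ^ 2 * (2 * M)) =
          2 * G.dim i * C * M * (s * δ) := by field_simp
      linarith
    rw [hvv]
    linarith

theorem intended_mem (hG : G.Regular) {c : G.Profile} {r : Fin N → ℝ} {δ : ℕ → ℝ} {q : ℝ}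
    {a₁ : G.Profile} (ha₁ : a₁ ∈ G.profiles) (l : ℕ → G.Profile) (J : Fin N → ℕ → Bool) (n : ℕ) :
    G.intended c r δ q a₁ l J n ∈ G.profiles := by
  induction n with
  | zero => exact ha₁
  | succ n ih =>
    intro i
    simp only [intended]
    split_ifs
    · exact (projOn_spec (hG.compact i).isClosed (hG.convex i) (hG.act_nonempty i) _).1
    · exact ih i

end Game

/-! ### The probabilistic model -/

theorem ae_summable_of_summable_integral {Ω : Type*} [MeasurableSpace Ω] {P : Measure Ω}
    {f : ℕ → Ω → ℝ} (hf0 : ∀ n ω, 0 ≤ f n ω) (hf : ∀ n, Integrable (f n) P)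
    (hsum : Summable fun n => ∫ ω, f n ω ∂P) : ∀ᵐ ω ∂P, Summable fun n => f n ω := by
  have h1 : ∫⁻ ω, ∑' n, ENNReal.ofReal (f n ω) ∂P ≠ ⊤ := by
    rw [lintegral_tsum fun n => (hf n).aemeasurable.ennreal_ofReal]
    have : ∀ n, ∫⁻ ω, ENNReal.ofReal (f n ω) ∂P = ENNReal.ofReal (∫ ω, f n ω ∂P) := fun n =>
      (ofReal_integral_eq_lintegral_ofReal (hf n) (Eventually.of_forall (hf0 n))).symm
    simp_rw [this]
    exact hsum.tsum_ofReal_ne_top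
  have h2 := ae_lt_top' (AEMeasurable.tsum
    fun n => (hf n).aemeasurable.ennreal_ofReal) h1
  filter_upwards [h2] with ω hω
  have h3 := ENNReal.summable_toReal hω.ne
  simpa [ENNReal.toReal_ofReal (hf0 _ ω)] using h3

theorem measurable_feedbackVal : Measurable feedbackVal := Measurable.of_discrete

theorem feedbackVal_nonneg (x : Bool) : 0 ≤ feedbackVal x := by unfold feedbackVal; split_ifs <;> simp

theorem feedbackVal_le_one (x : Bool) : feedbackVal x ≤ 1 := by unfold feedbackVal; split_ifs <;> simp

namespace Source

variable {N : ℕ}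

/-- The sources of randomness of the stages before `n`. -/
def past (n : ℕ) : Set (Source N) :=
  {s | match s with
    | .init => True
    | .dir _ t => t < n
    | .feedback _ t => t < n}

theorem past_mono : Monotone (past : ℕ → Set (Source N)) := by
  intro m n hmn s hs
  cases s with
  | init => trivial
  | dir i t => exact lt_of_lt_of_le (show t < m from hs) hmn
  | feedback i t => exact lt_of_lt_of_le (show t < m from hs) hmn

/-- The sources of randomness up to stage `n`, except for the direction of player `i`. -/
def pastExcept (i : Fin N) (n : ℕ) : Set (Source N) := past (n + 1) \ {.dir i n}

theorem past_subset_pastExcept (i : Fin N) (n : ℕ) : past n ⊆ pastExcept i n := by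
  refine fun s hs => ⟨past_mono n.le_succ hs, ?_⟩
  rintro rfl
  exact lt_irrefl n hs

/-- The direction withheld at stage `n` is released at stage `n + 1`, so these sets still form a
filtration. -/
theorem pastExcept_mono (i : Fin N) : Monotone (pastExcept i) :=
  monotone_nat_of_le_succ fun n _ hs => past_subset_pastExcept i (n + 1) hs.1

end Source

namespace LossyModel

section Sources

variable {Ω : Type*} {N : ℕ} {G : Game N} {a₁ : Ω → G.Profile}
  {lam : ∀ i, ℕ → Ω → EuclideanSpace ℝ (Fin (G.dim i))} {I : Fin N → ℕ → Ω → Bool}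

theorem measurable_init {S : Set (Source N)} (hS : .init ∈ S) :
    Measurable[⨆ s ∈ S, sourceSigma G a₁ lam I s] a₁ :=
  (comap_measurable a₁).mono (le_biSup (sourceSigma G a₁ lam I) hS) le_rfl

theorem measurable_dir {S : Set (Source N)} {i : Fin N} {n : ℕ} (hS : .dir i n ∈ S) :
    Measurable[⨆ s ∈ S, sourceSigma G a₁ lam I s] (lam i n) :=
  (comap_measurable (lam i n)).mono (le_biSup (sourceSigma G a₁ lam I) hS) le_rfl

theorem measurable_feedback {S : Set (Source N)} {i : Fin N} {n : ℕ} (hS : .feedback i n ∈ S) :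
    Measurable[⨆ s ∈ S, sourceSigma G a₁ lam I s] (I i n) :=
  (comap_measurable (I i n)).mono (le_biSup (sourceSigma G a₁ lam I) hS) le_rfl

end Sources

variable {Ω : Type*} [mΩ : MeasurableSpace Ω] {P : Measure Ω} {N : ℕ} {G : Game N}
  {p : Fin N → ℝ} {a₁ : Ω → G.Profile}
  {lam : ∀ i, ℕ → Ω → EuclideanSpace ℝ (Fin (G.dim i))} {I : Fin N → ℕ → Ω → Bool}

theorem sourceSigma_le (h : LossyModel P G p a₁ lam I) (s : Source N) :
    sourceSigma G a₁ lam I s ≤ mΩ := by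
  cases s with
  | init => exact h.init_measurable.comap_le
  | dir i n => exact (h.dir_measurable i n).comap_le
  | feedback i n => exact (h.feedback_measurable i n).comap_le

/-- The information carried by an increasing sequence of sets of sources. -/
def filtration (h : LossyModel P G p a₁ lam I) {S : ℕ → Set (Source N)} (hS : Monotone S) :
    Filtration ℕ mΩ where
  seq n := ⨆ s ∈ S n, sourceSigma G a₁ lam I s
  mono' _ _ hmn := biSup_mono fun _ hs => hS hmn hs
  le' _ := iSup₂_le fun s _ => h.sourceSigma_le s

theorem indep_of_disjoint (h : LossyModel P G p a₁ lam I) {S T : Set (Source N)}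
    (hST : Disjoint S T) {Z : Ω → ℝ} (hZ : Measurable[⨆ s ∈ S, sourceSigma G a₁ lam I s] Z) :
    Indep (MeasurableSpace.comap Z inferInstance) (⨆ s ∈ T, sourceSigma G a₁ lam I s) P :=
  indep_of_indep_of_le_left (indep_iSup_of_disjoint h.sourceSigma_le h.indep hST) hZ.comap_le

theorem integral_feedbackVal (h : LossyModel P G p a₁ lam I) (i : Fin N) (n : ℕ) :
    ∫ ω, feedbackVal (I i n ω) ∂P = p i := by
  have hm : MeasurableSet {ω | I i n ω = true} :=
    h.feedback_measurable i n (measurableSet_singleton true)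
  have : (fun ω => feedbackVal (I i n ω)) = {ω | I i n ω = true}.indicator 1 := by
    funext ω; simp [feedbackVal, Set.indicator]
  rw [this, integral_indicator_one hm, Measure.real, h.feedback_prob,
    ENNReal.toReal_ofReal (h.prob_pos i).le]

theorem measurable_feedbackVal (h : LossyModel P G p a₁ lam I) (i : Fin N) (n : ℕ) :
    Measurable fun ω => feedbackVal (I i n ω) :=
  _root_.measurable_feedbackVal.comp (h.feedback_measurable i n)

theorem indepFun_feedbackVal (h : LossyModel P G p a₁ lam I) (i : Fin N) {m n : ℕ} (hmn : m ≠ n) :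
    IndepFun (fun ω => feedbackVal (I i m ω)) (fun ω => feedbackVal (I i n ω)) P := by
  have h1 : IndepFun (I i m) (I i n) P := by
    rw [IndepFun_iff_Indep]
    exact h.indep.indep (i := .feedback i m) (j := .feedback i n) (by simpa using hmn)
  exact h1.comp _root_.measurable_feedbackVal _root_.measurable_feedbackVal

theorem integral_dir_coord (h : LossyModel P G p a₁ lam I) (i : Fin N) (n : ℕ)
    (j : Fin (G.dim i)) : ∫ ω, lam i n ω j ∂P = 0 := by
  rw [← integral_unifSphere_coord j, ← h.dir_law i n,
    integral_map (h.dir_measurable i n).aemeasurable (by fun_prop)]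

variable [IsProbabilityMeasure P]

theorem prob_le_one (h : LossyModel P G p a₁ lam I) (i : Fin N) : p i ≤ 1 := by
  have h1 : P {ω | I i 0 ω = true} ≤ 1 := MeasureTheory.prob_le_one
  rw [h.feedback_prob] at h1
  simpa using h1

theorem isProbabilityMeasure_unifSphere (h : LossyModel P G p a₁ lam I) (i : Fin N) :
    IsProbabilityMeasure (unifSphere (G.dim i)) :=
  h.dir_law i 0 ▸ Measure.isProbabilityMeasure_map (h.dir_measurable i 0).aemeasurable

theorem integrable_feedbackVal (h : LossyModel P G p a₁ lam I) (i : Fin N) (n : ℕ) :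
    Integrable (fun ω => feedbackVal (I i n ω)) P :=
  Integrable.of_bound (h.measurable_feedbackVal i n).aestronglyMeasurable 1
    (Eventually.of_forall fun ω => by
      rw [Real.norm_of_nonneg (feedbackVal_nonneg _)]; exact feedbackVal_le_one _)

theorem identDistrib_feedbackVal (h : LossyModel P G p a₁ lam I) (i : Fin N) (n : ℕ) :
    IdentDistrib (fun ω => feedbackVal (I i n ω)) (fun ω => feedbackVal (I i 0 ω)) P P := by
  have key : ∀ m, P {ω | I i m ω = false} = 1 - ENNReal.ofReal (p i) := fun m => by
    have hm : MeasurableSet {ω | I i m ω = true} :=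
      h.feedback_measurable i m (measurableSet_singleton true)
    rw [← h.feedback_prob i m, ← prob_compl_eq_one_sub hm]
    congr 1; ext ω; simp
  have h1 : IdentDistrib (I i n) (I i 0) P P := by
    refine ⟨(h.feedback_measurable i n).aemeasurable, (h.feedback_measurable i 0).aemeasurable, ?_⟩
    refine Measure.ext_of_singleton fun x => ?_
    rw [Measure.map_apply (h.feedback_measurable i n) (measurableSet_singleton x),
      Measure.map_apply (h.feedback_measurable i 0) (measurableSet_singleton x)]
    cases x with
    | true => exact (h.feedback_prob i n).trans (h.feedback_prob i 0).symm
    | false => exact (key n).trans (key 0).symm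
  exact h1.comp _root_.measurable_feedbackVal

/-- The truncation of the step sizes is eventually inactive. -/
theorem ae_eventually_le_count (h : LossyModel P G p a₁ lam I) (i : Fin N) :
    ∀ᵐ ω ∂P, ∀ᶠ n : ℕ in atTop,
      p i * ((n : ℝ) + 1) / 2 ≤ ∑ t ∈ Finset.range n, feedbackVal (I i t ω) + 1 := by
  filter_upwards [strong_law_ae_real (fun n ω => feedbackVal (I i n ω))
    (h.integrable_feedbackVal i 0) (fun m n hmn => h.indepFun_feedbackVal i hmn)
    (h.identDistrib_feedbackVal i)] with ω hω
  rw [h.integral_feedbackVal] at hω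
  have hp := h.prob_pos i
  filter_upwards [hω.eventually (lt_mem_nhds (half_lt_self hp)), eventually_gt_atTop 0] with n hn h0
  have hn0 : (0 : ℝ) < n := by exact_mod_cast h0
  rw [lt_div_iff₀ hn0] at hn
  have := h.prob_le_one i
  nlinarith

/-- The variance of the count is at most `n`. With `ρ = √(n + 1)`, the inequality `|y| ≤ ρ / 2 + y ^
2 / (2 * ρ)` turns it into a first-moment bound. -/
theorem integral_abs_count_sub_le (h : LossyModel P G p a₁ lam I) (i : Fin N) (n : ℕ) :
    ∫ ω, |∑ t ∈ Finset.range n, feedbackVal (I i t ω) + 1 - p i * ((n : ℝ) + 1)| ∂P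
      ≤ 2 * ((n : ℝ) + 1) ^ (1 / 2 : ℝ) := by
  set X : ℕ → Ω → ℝ := fun t ω => feedbackVal (I i t ω)
  have hX : ∀ t, MemLp (X t) 2 P := fun t =>
    MemLp.of_bound (h.measurable_feedbackVal i t).aestronglyMeasurable 1
      (Eventually.of_forall fun ω => by
        rw [Real.norm_of_nonneg (feedbackVal_nonneg _)]; exact feedbackVal_le_one _)
  set Y : Ω → ℝ := ∑ t ∈ Finset.range n, X t
  have hYm : MemLp Y 2 P := memLp_finsetSum' _ fun t _ => hX t
  have hEY : ∫ ω, Y ω ∂P = p i * n := by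
    simp only [Y, Finset.sum_apply]
    rw [integral_finsetSum _ fun t _ => h.integrable_feedbackVal i t]
    simp [h.integral_feedbackVal, mul_comm]
  have hvar : ∫ ω, (Y ω - p i * n) ^ 2 ∂P ≤ n := by
    have h1 := IndepFun.variance_sum (s := Finset.range n) (fun t _ => hX t)
      (fun s _ t _ hst => h.indepFun_feedbackVal i hst)
    have h2 : Var[Y; P] = ∫ ω, (Y ω - p i * n) ^ 2 ∂P := by
      rw [variance_eq_integral hYm.aestronglyMeasurable.aemeasurable, hEY]
    rw [← h2, h1]
    refine (Finset.sum_le_sum fun t _ => ?_ : _ ≤ ∑ t ∈ Finset.range n, (1 : ℝ)).trans (by simp)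
    refine (variance_le_expectation_sq (hX t).aestronglyMeasurable).trans ?_
    refine (integral_mono (hX t).integrable_sq (integrable_const 1) fun ω => ?_).trans (by simp)
    have h3 := feedbackVal_nonneg (I i t ω)
    have h4 := feedbackVal_le_one (I i t ω)
    simp only [X]
    nlinarith
  set m : ℝ := (n : ℝ) + 1
  have hm : 1 ≤ m := by simp [m]
  set ρ : ℝ := m ^ (1 / 2 : ℝ)
  have hρ : ρ ^ 2 = m := by
    rw [← Real.rpow_natCast, ← Real.rpow_mul (by linarith)]; norm_num
  have hρ1 : 1 ≤ ρ := Real.one_le_rpow hm (by norm_num)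
  have hp := h.prob_pos i
  have hp1 := h.prob_le_one i
  have hYint : Integrable (fun ω => (Y ω - p i * n) ^ 2) P :=
    (hYm.sub (memLp_const (p i * n))).integrable_sq
  have hle : ∀ ω, |∑ t ∈ Finset.range n, feedbackVal (I i t ω) + 1 - p i * m|
      ≤ (ρ / 2 + 1) + (2 * ρ)⁻¹ * (Y ω - p i * n) ^ 2 := by
    intro ω
    have h1 : ∑ t ∈ Finset.range n, feedbackVal (I i t ω) + 1 - p i * m
        = (Y ω - p i * n) + (1 - p i) := by simp [Y, X, m]; ring
    rw [h1]
    refine (abs_add_le _ _).trans ?_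
    have h2 : |1 - p i| ≤ 1 := by rw [abs_of_nonneg (by linarith)]; linarith
    have h3 : |Y ω - p i * n| ≤ ρ / 2 + (2 * ρ)⁻¹ * (Y ω - p i * n) ^ 2 := by
      rw [← sq_abs (Y ω - p i * n)]
      set y := |Y ω - p i * n|
      have h4 : ρ / 2 + (2 * ρ)⁻¹ * y ^ 2 - y = (2 * ρ)⁻¹ * (ρ - y) ^ 2 := by
        field_simp; ring
      have : 0 ≤ (2 * ρ)⁻¹ * (ρ - y) ^ 2 := by positivity
      linarith
    linarith
  refine (integral_mono_of_nonneg (Eventually.of_forall fun ω => abs_nonneg _)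
    ((integrable_const (ρ / 2 + 1)).add (hYint.const_mul (2 * ρ)⁻¹))
    (Eventually.of_forall hle)).trans ?_
  simp only [Pi.add_apply]
  rw [integral_add (integrable_const _) (hYint.const_mul _), integral_const_mul]
  simp only [integral_const, probReal_univ, one_smul]
  have h5 : (2 * ρ)⁻¹ * ∫ ω, (Y ω - p i * n) ^ 2 ∂P ≤ ρ / 2 := by
    rw [inv_mul_le_iff₀ (by positivity)]
    have : 2 * ρ * (ρ / 2) = m := by rw [← hρ]; ring
    rw [this]
    exact hvar.trans (by simp [m])
  linarith

/-- Summability of the deviations of the truncated step sizes from their equivalents. -/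
theorem ae_summable_truncStep_sub (h : LossyModel P G p a₁ lam I) (i : Fin N) {q : ℝ}
    (hq : 1 / 2 < q) :
    ∀ᵐ ω ∂P, Summable fun n : ℕ =>
      |p i ^ (q - 1) * (p i * truncStep q (p i) (fun t => I i t ω) n) - ((n : ℝ) + 1) ^ (-q)| := by
  have hint : ∀ n : ℕ, Integrable (fun ω => ((n : ℝ) + 1) ^ (-q - 1) *
      |∑ t ∈ Finset.range n, feedbackVal (I i t ω) + 1 - p i * ((n : ℝ) + 1)|) P := fun n =>
    ((((integrable_finsetSum _ fun t _ => h.integrable_feedbackVal i t).add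
      (integrable_const 1)).sub (integrable_const (p i * ((n : ℝ) + 1)))).abs).const_mul _
  have hsum := ae_summable_of_summable_integral (P := P) (fun n ω => by positivity) hint (by
    -- The expected deviation at stage `n` is of order `(n + 1) ^ (-q - 1) * (n + 1) ^ (1 / 2)`,
    -- summable since `q > 1 / 2`.
    have h1 : Summable fun n : ℕ => 2 * ((n : ℝ) + 1) ^ (-(q + 1 / 2)) := by
      have := (summable_nat_add_iff 1).2 (Real.summable_nat_rpow (p := -(q + 1 / 2)) |>.2 (by linarith))
      simpa using this.mul_left 2
    refine Summable.of_nonneg_of_le (fun n => integral_nonneg fun ω => by positivity)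
      (fun n => ?_) h1
    rw [integral_const_mul]
    refine (mul_le_mul_of_nonneg_left (h.integral_abs_count_sub_le i n) (by positivity)).trans
      (le_of_eq ?_)
    rw [show -(q + 1 / 2) = (-q - 1) + 1 / 2 by ring, Real.rpow_add (by positivity)]
    ring)
  filter_upwards [hsum] with ω hω
  exact Summable.of_nonneg_of_le (fun n => abs_nonneg _)
    (fun n => abs_truncStep_sub_le (h.prob_pos i) (by linarith)) (hω.mul_left _)

/-- Feedback and direction of the same stage are independent, so the mean of the product is `p i`
times the spherical covariance. -/
theorem integral_covFluct (h : LossyModel P G p a₁ lam I) (i : Fin N) (n : ℕ)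
    (j k : Fin (G.dim i)) : ∫ ω, Game.covFluct (p i) (I i n ω) (lam i n ω) j k ∂P = 0 := by
  have := h.isProbabilityMeasure_unifSphere i
  have h1 : ∫ ω, lam i n ω j * lam i n ω k ∂P = ∫ x, x j * x k ∂unifSphere (G.dim i) := by
    rw [← h.dir_law i n, integral_map (h.dir_measurable i n).aemeasurable (by fun_prop)]
  have h2 : IndepFun (I i n) (lam i n) P := by
    rw [IndepFun_iff_Indep]
    exact h.indep.indep (i := .feedback i n) (j := .dir i n) (by simp)
  have h3 : IndepFun (fun ω => feedbackVal (I i n ω)) (fun ω => lam i n ω j * lam i n ω k) P :=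
    h2.comp _root_.measurable_feedbackVal
      (ψ := fun x : EuclideanSpace ℝ (Fin (G.dim i)) => x j * x k) (by fun_prop)
  have hm := h.dir_measurable i n
  have hm2 : Measurable fun ω => lam i n ω j * lam i n ω k :=
    (by fun_prop : Measurable fun x : EuclideanSpace ℝ (Fin (G.dim i)) => x j * x k).comp hm
  have hnorm : ∀ᵐ ω ∂P, ‖lam i n ω‖ = 1 := by
    have h4 := ae_unifSphere_norm_eq_one (d := G.dim i)
    rw [← h.dir_law i n] at h4
    exact ae_of_ae_map hm.aemeasurable h4
  have h5 : Integrable (fun ω => feedbackVal (I i n ω) * (lam i n ω j * lam i n ω k)) P := by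
    refine Integrable.of_bound
      ((h.measurable_feedbackVal i n).mul hm2).aestronglyMeasurable 1 ?_
    filter_upwards [hnorm] with ω hω
    have h6 := PiLp.norm_apply_le (lam i n ω) j
    have h7 := PiLp.norm_apply_le (lam i n ω) k
    rw [hω] at h6 h7
    rw [norm_mul, norm_mul, Real.norm_of_nonneg (feedbackVal_nonneg _)]
    exact mul_le_one₀ (feedbackVal_le_one _) (by positivity)
      (mul_le_one₀ h6 (norm_nonneg _) h7)
  simp only [Game.covFluct]
  rw [integral_sub (h5.const_mul _) (integrable_const _), integral_const_mul,
    h3.integral_fun_mul_eq_mul_integral (h.measurable_feedbackVal i n).aestronglyMeasurable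
      hm2.aestronglyMeasurable, h.integral_feedbackVal, h1, mul_left_comm,
    integral_unifSphere_coord_mul]
  simp

end LossyModel

/-! ### Measurability of the algorithm -/

namespace Game

variable {N : ℕ} {G : Game N}

/-- The intended actions as random variables. -/
noncomputable def randomIntended {Ω : Type*} (G : Game N) (c : G.Profile) (r : Fin N → ℝ)
    (δ : ℕ → ℝ) (q : ℝ) (a₁ : Ω → G.Profile)
    (lam : ∀ i, ℕ → Ω → EuclideanSpace ℝ (Fin (G.dim i))) (I : Fin N → ℕ → Ω → Bool)
    (n : ℕ) (ω : Ω) : G.Profile :=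
  G.intended c r δ q (a₁ ω) (fun m i => lam i m ω) (fun i m => I i m ω) n

section Measurability

variable {Ω : Type*} {mΩ : MeasurableSpace Ω}

/-- Utilities are unconstrained off the profiles, so measurability needs a map that takes feasible
values surely. This is why directions are first assumed to lie in the unit ball everywhere. -/
theorem measurable_comp_of_continuousOn {X : Type*} [TopologicalSpace X] [MeasurableSpace X]
    [BorelSpace X] {u : G.Profile → X} (hu : ContinuousOn u G.profiles)
    {f : Ω → G.Profile} (hf : Measurable f) (hmem : ∀ ω, f ω ∈ G.profiles) :
    Measurable fun ω => u (f ω) :=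
  (continuousOn_iff_continuous_domRestrict.1 hu).measurable.comp (hf.subtype_mk (h := hmem))

theorem measurable_perturb {c : G.Profile} {r : Fin N → ℝ} {δ : ℝ} {f l : Ω → G.Profile}
    (hf : Measurable f) (hl : Measurable l) :
    Measurable fun ω => G.perturb c r δ (f ω) (l ω) := by
  refine measurable_pi_iff.2 fun i => ?_
  have h1 : Measurable fun ω => f ω i := (measurable_pi_apply i).comp hf
  have h2 : Measurable fun ω => l ω i := (measurable_pi_apply i).comp hl
  have h3 : Measurable fun ω => l ω i - (r i)⁻¹ • (f ω i - c i) :=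
    h2.sub ((h1.sub_const (c i)).const_smul (r i)⁻¹)
  exact h1.add (h3.const_smul δ)

theorem measurable_truncStep {q p : ℝ} {J : ℕ → Ω → Bool} {n : ℕ}
    (hJ : ∀ t < n, Measurable (J t)) : Measurable fun ω => truncStep q p (fun t => J t ω) n := by
  have h1 : Measurable fun ω => ∑ t ∈ Finset.range n, feedbackVal (J t ω) :=
    Finset.measurable_fun_sum _ fun t ht =>
      measurable_feedbackVal.comp (hJ t (Finset.mem_range.1 ht))
  exact ((h1.add_const 1).max measurable_const).pow_const _

theorem measurable_stepSize {q : ℝ} {J : ℕ → Ω → Bool} {n : ℕ}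
    (hJ : ∀ t < n + 1, Measurable (J t)) : Measurable fun ω => stepSize q (fun t => J t ω) n := by
  have h1 : Measurable fun ω => feedbackCount (fun t => J t ω) n :=
    Finset.measurable_fun_sum _ fun t ht =>
      (Measurable.of_discrete (f := fun b : Bool => if b = true then (1 : ℕ) else 0)).comp
        (hJ t (Finset.mem_range.1 ht))
  exact (Measurable.of_discrete (f := fun k : ℕ => 1 / (k : ℝ) ^ q)).comp h1

theorem Regular.measurable_randomIntended (hG : G.Regular) {c : G.Profile} {r : Fin N → ℝ}
    (hr : ∀ i, 0 < r i) (hball : ∀ i, Metric.closedBall (c i) (r i) ⊆ G.act i)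
    {δ : ℕ → ℝ} (hδ : ∀ n, 0 < δ n) (hδr : ∀ n i, δ n ≤ r i) {q : ℝ} {a₁ : Ω → G.Profile}
    {lam : ∀ i, ℕ → Ω → EuclideanSpace ℝ (Fin (G.dim i))} {I : Fin N → ℕ → Ω → Bool}
    (ha₁ : Measurable a₁) (hmem : ∀ ω, a₁ ω ∈ G.profiles) (hle : ∀ i n ω, ‖lam i n ω‖ ≤ 1)
    {n : ℕ} (hlam : ∀ i, ∀ t < n, Measurable (lam i t)) (hI : ∀ i, ∀ t < n, Measurable (I i t)) :
    Measurable (G.randomIntended c r δ q a₁ lam I n) := by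
  induction n with
  | zero => exact ha₁
  | succ n ih =>
    have hA := ih (fun i t ht => hlam i t (by omega)) (fun i t ht => hI i t (by omega))
    have hl : Measurable fun ω i => lam i n ω := measurable_pi_iff.2 fun i => hlam i n n.lt_succ_self
    refine measurable_pi_iff.2 fun i => ?_
    have hAi := (measurable_pi_apply i).comp hA
    have hli := hlam i n n.lt_succ_self
    have hu := measurable_comp_of_continuousOn (hG.util_continuous i)
      (measurable_perturb (c := c) (r := r) (δ := δ n) hA hl)
      fun ω => perturb_mem hG.convex hr hball (hδ n).le (hδr n)
        (intended_mem hG (hmem ω) _ _ n) fun j => hle j n ω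
    have hproj := (continuous_projOn (hG.compact i).isClosed (hG.convex i)
      (hG.act_nonempty i)).measurable
    exact Measurable.ite (hI i n n.lt_succ_self (measurableSet_singleton true))
      (hproj.comp (hAi.add ((measurable_stepSize (q := q) (hI i)).smul ((hu.const_mul _).smul hli))))
      hAi

end Measurability

end Game

/-! ### Convergence of the noise and of the algorithm -/

theorem summable_nat_succ_rpow {s : ℝ} (hs : 1 < s) : Summable fun n : ℕ => ((n : ℝ) + 1) ^ (-s) := by
  have := (summable_nat_add_iff 1).2 (Real.summable_nat_rpow (p := -s) |>.2 (by linarith))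
  simpa using this

theorem not_summable_nat_succ_rpow {s : ℝ} (hs : s ≤ 1) :
    ¬ Summable fun n : ℕ => ((n : ℝ) + 1) ^ (-s) := by
  intro h
  have h1 : Summable fun n : ℕ => ((n + 1 : ℕ) : ℝ) ^ (-s) := by simpa using h
  have h2 := (summable_nat_add_iff 1 (f := fun n : ℕ => (n : ℝ) ^ (-s))).1 h1
  have := Real.summable_nat_rpow.1 h2
  linarith

theorem exists_tendsto_sum_range_sum {ι : Type*} [Fintype ι] {f : ℕ → ι → ℝ}
    (h : ∀ j, ∃ l, Tendsto (fun n => ∑ k ∈ Finset.range n, f k j) atTop (𝓝 l)) :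
    ∃ l, Tendsto (fun n => ∑ k ∈ Finset.range n, ∑ j, f k j) atTop (𝓝 l) := by
  choose l hl using h
  refine ⟨∑ j, l j, ?_⟩
  simp_rw [Finset.sum_comm (s := Finset.range _)]
  exact tendsto_finsetSum _ fun j _ => hl j

namespace LossyModel

variable {Ω : Type*} [mΩ : MeasurableSpace Ω] {P : Measure Ω} {N : ℕ}
  {G : Game N} {p : Fin N → ℝ} {a₁ : Ω → G.Profile}
  {lam : ∀ i, ℕ → Ω → EuclideanSpace ℝ (Fin (G.dim i))} {I : Fin N → ℕ → Ω → Bool}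
  {c : G.Profile} {r : Fin N → ℝ} {q : ℝ} {δ : ℕ → ℝ}

section SureBound

variable (h : LossyModel P G p a₁ lam I) (hle : ∀ i n ω, ‖lam i n ω‖ ≤ 1) (hG : G.Regular)
  (hr : ∀ i, 0 < r i) (hball : ∀ i, Metric.closedBall (c i) (r i) ⊆ G.act i)
  (hδ : ∀ n, 0 < δ n) (hδr : ∀ n i, δ n ≤ r i) (hq : 1 / 2 < q)
include h hle hG hr hball hδ hδr

theorem measurable_randomIntended {n : ℕ} {S : Set (Source N)} (hS : Source.past n ⊆ S) :
    Measurable[⨆ s ∈ S, sourceSigma G a₁ lam I s] (G.randomIntended c r δ q a₁ lam I n) :=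
  hG.measurable_randomIntended hr hball hδ hδr (measurable_init (hS trivial)) h.init_mem hle
    (fun _ _ ht => measurable_dir (hS ht)) (fun _ _ ht => measurable_feedback (hS ht))

variable [IsProbabilityMeasure P]

include hq in
-- The weight involves the current feedback and the other players' current directions, hence the
-- filtration that withholds only `lam i n`. Its bound of order `k ^ (-q) / δ` is square summable by
-- `hδs`.
theorem ae_tendsto_sum_valueWeight
    (hδs : Summable fun n : ℕ => ((n : ℝ) + 1) ^ (-2 * q) * (δ n ^ 2)⁻¹) (i : Fin N)
    {b : EuclideanSpace ℝ (Fin (G.dim i))} (hb : b ∈ G.act i) (j : Fin (G.dim i)) :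
    ∀ᵐ ω ∂P, ∃ S, Tendsto (fun n => ∑ k ∈ Finset.range n,
      G.valueWeight c r (δ k) (truncStep q (p i) (fun t => I i t ω) k)
        (G.randomIntended c r δ q a₁ lam I k ω) (fun i' => lam i' k ω) (I i k ω) i b j
        * lam i k ω j) atTop (𝓝 S) := by
  obtain ⟨M, hM0, hM⟩ := hG.exists_bound
  have hp := h.prob_pos i
  have hA : ∀ n ω, G.randomIntended c r δ q a₁ lam I n ω ∈ G.profiles := fun n ω =>
    Game.intended_mem hG (h.init_mem ω) _ _ n
  have hl0 : ∀ n ω j', ‖Function.update (fun i' => lam i' n ω) i 0 j'‖ ≤ 1 := fun n ω j' => by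
    rcases eq_or_ne j' i with rfl | hne
    · simp
    · simpa [hne] using hle j' n ω
  have hmem : ∀ n ω, G.perturb c r (δ n) (G.randomIntended c r δ q a₁ lam I n ω)
      (Function.update (fun i' => lam i' n ω) i 0) ∈ G.profiles := fun n ω =>
    Game.perturb_mem hG.convex hr hball (hδ n).le (hδr n) (hA n ω) (hl0 n ω)
  set K : ℝ := (p i / 2) ^ (-q) * G.dim i * M * (2 * M) with hK
  refine ae_exists_tendsto_sum_mul (h.filtration (Source.pastExcept_mono i))
    (c := fun n => K * (((n : ℝ) + 1) ^ (-q) * (δ n)⁻¹)) (B := 1) ?_ ?_ ?_ ?_ ?_ ?_ ?_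
  · intro n
    change Measurable[⨆ s ∈ Source.pastExcept i n, sourceSigma G a₁ lam I s] _
    have hsub := Source.past_subset_pastExcept i n
    have hAm := h.measurable_randomIntended hle hG hr hball hδ hδr (q := q) hsub
    have hs : Measurable[⨆ s ∈ Source.pastExcept i n, sourceSigma G a₁ lam I s]
        fun ω => truncStep q (p i) (fun t => I i t ω) n :=
      Game.measurable_truncStep fun t ht => measurable_feedback (hsub ht)
    have hx : Measurable[⨆ s ∈ Source.pastExcept i n, sourceSigma G a₁ lam I s]
        fun ω => feedbackVal (I i n ω) :=
      _root_.measurable_feedbackVal.comp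
        (measurable_feedback ⟨Nat.lt_succ_self n, by simp⟩)
    have hl : Measurable[⨆ s ∈ Source.pastExcept i n, sourceSigma G a₁ lam I s]
        fun ω => (Function.update (fun i' => lam i' n ω) i 0 : G.Profile) := by
      refine (@measurable_pi_iff _ _ _ (_) _ _).2 fun j' => ?_
      rcases eq_or_ne j' i with rfl | hne
      · simp only [Function.update_self]; exact measurable_const
      · simp only [Function.update_of_ne hne]
        exact measurable_dir ⟨Nat.lt_succ_self n, by simpa using hne⟩
    have hu := Game.measurable_comp_of_continuousOn (hG.util_continuous i)
      (Game.measurable_perturb (c := c) (r := r) (δ := δ n) hAm hl) (hmem n)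
    have hAj : Measurable[⨆ s ∈ Source.pastExcept i n, sourceSigma G a₁ lam I s]
        fun ω => G.randomIntended c r δ q a₁ lam I n ω i j :=
      (by fun_prop : Measurable fun a : G.Profile => a i j).comp hAm
    exact (((hs.mul hx).mul_const _).mul hu).mul (hAj.sub_const _)
  · intro n ω
    have h1 := truncStep_le (q := q) (J := fun t => I i t ω) (n := n) hp (by linarith)
    have h2 := truncStep_nonneg (q := q) (J := fun t => I i t ω) (n := n) hp
    have h3 : |G.randomIntended c r δ q a₁ lam I n ω i j - b j| ≤ 2 * M := by
      have hb' : ‖b‖ ≤ M := by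
        have := (hM i _ (Game.update_mem_profiles (hA n ω) hb)).1
        rwa [Function.update_self] at this
      have h4 := PiLp.norm_apply_le (G.randomIntended c r δ q a₁ lam I n ω i - b) j
      have h5 := norm_sub_le (G.randomIntended c r δ q a₁ lam I n ω i) b
      have h6 := (hM i _ (hA n ω)).1
      rw [PiLp.sub_apply, Real.norm_eq_abs] at h4
      linarith
    have hδn := hδ n
    simp only [Game.valueWeight]
    rw [abs_mul, abs_mul, abs_mul, abs_mul, abs_of_nonneg h2, abs_of_nonneg (feedbackVal_nonneg _),
      abs_of_nonneg (by positivity : 0 ≤ (G.dim i : ℝ) / δ n)]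
    calc _ ≤ ((p i / 2) ^ (-q) * ((n : ℝ) + 1) ^ (-q)) * 1 * ((G.dim i : ℝ) / δ n) * M * (2 * M) := by
          gcongr
          · exact feedbackVal_nonneg _
          · exact feedbackVal_le_one _
          · exact (hM i _ (hmem n ω)).2.1
      _ = _ := by rw [hK]; ring
  · have : ∀ n : ℕ, (K * (((n : ℝ) + 1) ^ (-q) * (δ n)⁻¹)) ^ 2
        = K ^ 2 * (((n : ℝ) + 1) ^ (-2 * q) * (δ n ^ 2)⁻¹) := fun n => by
      rw [show (-2 * q) = -q * (2 : ℕ) by push_cast; ring, Real.rpow_mul (by positivity),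
        Real.rpow_natCast]
      field_simp
    simp_rw [this]
    exact hδs.mul_left _
  · intro n
    exact (by fun_prop : Measurable fun x : EuclideanSpace ℝ (Fin (G.dim i)) => x j).comp
      (measurable_dir (S := Source.pastExcept i (n + 1))
        ⟨show n < n + 1 + 1 by omega, by simp⟩)
  · intro n ω
    exact (PiLp.norm_apply_le (lam i n ω) j).trans (hle i n ω)
  · intro n
    refine h.indep_of_disjoint (S := {.dir i n}) (T := Source.pastExcept i n)
      (Set.disjoint_singleton_left.2 fun hs => hs.2 rfl) ?_
    exact (by fun_prop : Measurable fun x : EuclideanSpace ℝ (Fin (G.dim i)) => x j).comp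
      (measurable_dir rfl)
  · exact fun n => h.integral_dir_coord i n j

include hq in
-- Here the innovation contains the current feedback as well, so the weights must depend on earlier
-- stages only; no factor `1 / δ` remains.
theorem ae_tendsto_sum_gradWeight (i : Fin N)
    {b : EuclideanSpace ℝ (Fin (G.dim i))} (hb : b ∈ G.act i) (j l : Fin (G.dim i)) :
    ∀ᵐ ω ∂P, ∃ S, Tendsto (fun n => ∑ k ∈ Finset.range n,
      G.gradWeight (truncStep q (p i) (fun t => I i t ω) k)
        (G.randomIntended c r δ q a₁ lam I k ω) i b j l
        * Game.covFluct (p i) (I i k ω) (lam i k ω) j l) atTop (𝓝 S) := by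
  obtain ⟨M, hM0, hM⟩ := hG.exists_bound
  have hp := h.prob_pos i
  have hA : ∀ n ω, G.randomIntended c r δ q a₁ lam I n ω ∈ G.profiles := fun n ω =>
    Game.intended_mem hG (h.init_mem ω) _ _ n
  set K : ℝ := (p i / 2) ^ (-q) * M * (2 * M) with hK
  have hcov : ∀ n (S : Set (Source N)), Source.dir i n ∈ S → Source.feedback i n ∈ S →
      Measurable[⨆ s ∈ S, sourceSigma G a₁ lam I s]
        fun ω => Game.covFluct (p i) (I i n ω) (lam i n ω) j l := by
    intro n S hS1 hS2
    have h1 : Measurable[⨆ s ∈ S, sourceSigma G a₁ lam I s] fun ω => lam i n ω j * lam i n ω l :=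
      (by fun_prop : Measurable fun x : EuclideanSpace ℝ (Fin (G.dim i)) => x j * x l).comp
        (measurable_dir hS1)
    have h2 : Measurable[⨆ s ∈ S, sourceSigma G a₁ lam I s] fun ω => feedbackVal (I i n ω) :=
      _root_.measurable_feedbackVal.comp (measurable_feedback hS2)
    exact ((h2.mul h1).const_mul _).sub_const _
  refine ae_exists_tendsto_sum_mul (h.filtration Source.past_mono)
    (c := fun n => K * ((n : ℝ) + 1) ^ (-q)) (B := G.dim i + p i) ?_ ?_ ?_ ?_ ?_ ?_ ?_
  · intro n
    change Measurable[⨆ s ∈ Source.past n, sourceSigma G a₁ lam I s] _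
    have hAm := h.measurable_randomIntended hle hG hr hball hδ hδr (q := q) (n := n) subset_rfl
    have hs : Measurable[⨆ s ∈ Source.past n, sourceSigma G a₁ lam I s]
        fun ω => truncStep q (p i) (fun t => I i t ω) n :=
      Game.measurable_truncStep fun t ht => measurable_feedback ht
    have hg := Game.measurable_comp_of_continuousOn (hG.continuousOn_grad i) hAm (hA n)
    have hgj : Measurable[⨆ s ∈ Source.past n, sourceSigma G a₁ lam I s]
        fun ω => G.grad i (G.randomIntended c r δ q a₁ lam I n ω) j :=
      (by fun_prop : Measurable fun x : EuclideanSpace ℝ (Fin (G.dim i)) => x j).comp hg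
    have hAj : Measurable[⨆ s ∈ Source.past n, sourceSigma G a₁ lam I s]
        fun ω => G.randomIntended c r δ q a₁ lam I n ω i l :=
      (by fun_prop : Measurable fun a : G.Profile => a i l).comp hAm
    exact (hs.mul hgj).mul (hAj.sub_const _)
  · intro n ω
    have h1 := truncStep_le (q := q) (J := fun t => I i t ω) (n := n) hp (by linarith)
    have h2 := truncStep_nonneg (q := q) (J := fun t => I i t ω) (n := n) hp
    have h3 : |G.randomIntended c r δ q a₁ lam I n ω i l - b l| ≤ 2 * M := by
      have hb' : ‖b‖ ≤ M := by
        have := (hM i _ (Game.update_mem_profiles (hA n ω) hb)).1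
        rwa [Function.update_self] at this
      have h4 := PiLp.norm_apply_le (G.randomIntended c r δ q a₁ lam I n ω i - b) l
      have h5 := norm_sub_le (G.randomIntended c r δ q a₁ lam I n ω i) b
      have h6 := (hM i _ (hA n ω)).1
      rw [PiLp.sub_apply, Real.norm_eq_abs] at h4
      linarith
    have h7 : |G.grad i (G.randomIntended c r δ q a₁ lam I n ω) j| ≤ M :=
      (PiLp.norm_apply_le _ j).trans (hM i _ (hA n ω)).2.2
    simp only [Game.gradWeight]
    rw [abs_mul, abs_mul, abs_of_nonneg h2]
    calc _ ≤ ((p i / 2) ^ (-q) * ((n : ℝ) + 1) ^ (-q)) * M * (2 * M) := by gcongr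
      _ = _ := by rw [hK]; ring
  · have : ∀ n : ℕ, (K * ((n : ℝ) + 1) ^ (-q)) ^ 2 = K ^ 2 * ((n : ℝ) + 1) ^ (-(2 * q)) := fun n => by
      rw [show -(2 * q) = -q * (2 : ℕ) by push_cast; ring, Real.rpow_mul (by positivity),
        Real.rpow_natCast, mul_pow]
    simp_rw [this]
    exact (summable_nat_succ_rpow (by linarith)).mul_left _
  · intro n
    exact hcov n (Source.past (n + 1)) n.lt_succ_self n.lt_succ_self
  · intro n ω
    have h1 := (PiLp.norm_apply_le (lam i n ω) j).trans (hle i n ω)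
    have h2 := (PiLp.norm_apply_le (lam i n ω) l).trans (hle i n ω)
    have h3 : |feedbackVal (I i n ω) * (lam i n ω j * lam i n ω l)| ≤ 1 := by
      rw [abs_mul, abs_mul, abs_of_nonneg (feedbackVal_nonneg _)]
      exact mul_le_one₀ (feedbackVal_le_one _) (by positivity) (mul_le_one₀ h1 (abs_nonneg _) h2)
    refine (abs_sub _ _).trans (add_le_add ?_ ?_)
    · rw [abs_mul, abs_of_nonneg (by positivity : (0 : ℝ) ≤ G.dim i)]
      exact mul_le_of_le_one_right (by positivity) h3
    · split_ifs
      · rw [abs_of_pos hp]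
      · simpa using hp.le
  · intro n
    refine h.indep_of_disjoint (S := {.dir i n, .feedback i n}) (T := Source.past n) ?_
      (hcov n _ (by simp) (by simp))
    rw [Set.disjoint_insert_left, Set.disjoint_singleton_left]
    exact ⟨lt_irrefl n, lt_irrefl n⟩
  · exact fun n => h.integral_covFluct i n j l

include hq in
/-- Perturbed descent of the weighted distance of one player to a fixed action. -/
theorem ae_exists_descent (hδs : Summable fun n : ℕ => ((n : ℝ) + 1) ^ (-q) * δ n)
    (hδs' : Summable fun n : ℕ => ((n : ℝ) + 1) ^ (-2 * q) * (δ n ^ 2)⁻¹) (i : Fin N)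
    {b : EuclideanSpace ℝ (Fin (G.dim i))} (hb : b ∈ G.act i) :
    ∀ᵐ ω ∂P, ∃ e : ℕ → ℝ, (∃ S, Tendsto (fun n => ∑ k ∈ Finset.range n, e k) atTop (𝓝 S)) ∧
      ∀ᶠ n in atTop,
        p i ^ (q - 1) * ‖G.randomIntended c r δ q a₁ lam I (n + 1) ω i - b‖ ^ 2 ≤
          p i ^ (q - 1) * ‖G.randomIntended c r δ q a₁ lam I n ω i - b‖ ^ 2
          + ((n : ℝ) + 1) ^ (-q) * (2 * inner ℝ
            (G.grad i (G.randomIntended c r δ q a₁ lam I n ω))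
            (G.randomIntended c r δ q a₁ lam I n ω i - b)) + e n := by
  obtain ⟨M, hM0, hM⟩ := hG.exists_bound
  obtain ⟨C, hC0, hC⟩ := hG.exists_expansion hr hball i
  have hp := h.prob_pos i
  filter_upwards [h.ae_eventually_le_count i, h.ae_summable_truncStep_sub i hq,
    ae_all_iff.2 fun j => h.ae_tendsto_sum_valueWeight hle hG hr hball hδ hδr hq hδs' i hb j,
    ae_all_iff.2 fun j => ae_all_iff.2 fun l =>
      h.ae_tendsto_sum_gradWeight hle hG hr hball hδ hδr hq i hb j l] with ω hcount hdev hval hgrad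
  set A := fun n => G.randomIntended c r δ q a₁ lam I n ω with hAdef
  have hA : ∀ n, A n ∈ G.profiles := fun n => Game.intended_mem hG (h.init_mem ω) _ _ n
  set w := p i ^ (q - 1) with hw
  have hw0 : 0 < w := Real.rpow_pos_of_pos hp _
  set s : ℕ → ℝ := truncStep q (p i) fun t => I i t ω with hs
  set K := (p i / 2) ^ (-q) with hK
  have hs0 : ∀ n, 0 ≤ s n := fun n => truncStep_nonneg hp
  have hsK : ∀ n, s n ≤ K * ((n : ℝ) + 1) ^ (-q) := fun n => truncStep_le hp (by linarith)
  obtain ⟨S₁, hS₁⟩ := exists_tendsto_sum_range_sum hval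
  obtain ⟨S₂, hS₂⟩ := exists_tendsto_sum_range_sum fun j => exists_tendsto_sum_range_sum (hgrad j)
  have hsum3 : Summable fun n => s n * δ n := by
    refine Summable.of_nonneg_of_le (fun n => mul_nonneg (hs0 n) (hδ n).le) (fun n => ?_)
      (hδs.mul_left K)
    rw [← mul_assoc]
    exact mul_le_mul_of_nonneg_right (hsK n) (hδ n).le
  have hsum4 : Summable fun n => s n ^ 2 * (δ n ^ 2)⁻¹ := by
    refine Summable.of_nonneg_of_le (fun n => by positivity) (fun n => ?_) (hδs'.mul_left (K ^ 2))
    rw [← mul_assoc]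
    refine mul_le_mul_of_nonneg_right ?_ (by positivity)
    refine (pow_le_pow_left₀ (hs0 n) (hsK n) 2).trans (le_of_eq ?_)
    rw [show (-2 * q) = -q * (2 : ℕ) by push_cast; ring, Real.rpow_mul (by positivity),
        Real.rpow_natCast, mul_pow]
  have hin : ∀ n, |inner ℝ (G.grad i (A n)) (A n i - b)| ≤ M * (2 * M) := by
    intro n
    refine (abs_real_inner_le_norm _ _).trans ?_
    have hb' : ‖b‖ ≤ M := by
      have := (hM i _ (Game.update_mem_profiles (hA n) hb)).1
      rwa [Function.update_self] at this
    have h5 := norm_sub_le (A n i) b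
    have h6 := hM i _ (hA n)
    exact mul_le_mul h6.2.2 (by linarith) (norm_nonneg _) hM0.le
  -- The error collects the two martingale transforms, whose series need not converge absolutely,
  -- and three summable terms: replacement of the step by its equivalent, bias, and squared step.
  refine ⟨fun n =>
    2 * w * (∑ j, G.valueWeight c r (δ n) (s n) (A n) (fun i' => lam i' n ω) (I i n ω) i b j
      * lam i n ω j)
    + 2 * w * (∑ j, ∑ l, G.gradWeight (s n) (A n) i b j l
      * Game.covFluct (p i) (I i n ω) (lam i n ω) j l)
    + (2 * (M * (2 * M)) * |w * (p i * s n) - ((n : ℝ) + 1) ^ (-q)|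
      + w * (4 * G.dim i * C * M) * (s n * δ n)
      + w * (G.dim i * M) ^ 2 * (s n ^ 2 * (δ n ^ 2)⁻¹)), ?_, ?_⟩
  · have hsum5 := ((hdev.mul_left (2 * (M * (2 * M)))).add
      (hsum3.mul_left (w * (4 * G.dim i * C * M)))).add
      (hsum4.mul_left (w * (G.dim i * M) ^ 2))
    refine ⟨_, (((hS₁.const_mul (2 * w)).add (hS₂.const_mul (2 * w))).add
      hsum5.hasSum.tendsto_sum_nat).congr fun n => ?_⟩
    rw [Finset.mul_sum, Finset.mul_sum, ← Finset.sum_add_distrib, ← Finset.sum_add_distrib]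
  · filter_upwards [hcount] with n hn
    have hstep := hG.norm_step_sub_sq_le hr hball hM (hδ n) (hδr n) (hA n)
      (l := fun i' => lam i' n ω) (fun j => hle j n ω)
      (hC (δ n) (hδ n).le (hδr n) (A n) (hA n) (fun i' => lam i' n ω) fun j => hle j n ω)
      hb (hs0 n) (p i) (I i n ω)
    have hnext : A (n + 1) i = if I i n ω = true then projOn (G.act i) (A n i + s n •
        G.gradEst (δ n) (G.perturb c r (δ n) (A n) fun i' => lam i' n ω)
          (fun i' => lam i' n ω) i) else A n i := by
      have h1 : A (n + 1) i = if I i n ω = true then projOn (G.act i) (A n i +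
          stepSize q (fun t => I i t ω) n •
          G.gradEst (δ n) (G.perturb c r (δ n) (A n) fun i' => lam i' n ω)
            (fun i' => lam i' n ω) i) else A n i := rfl
      rw [h1]
      split_ifs with hI
      -- The true and truncated steps are compared only when feedback arrives; otherwise the action
      -- does not move.
      · rw [stepSize_eq_truncStep (p := p i) hI hn]
      · rfl
    rw [← hnext] at hstep
    have h2 := mul_le_mul_of_nonneg_left hstep hw0.le
    have h3 : w * (p i * s n * inner ℝ (G.grad i (A n)) (A n i - b)) ≤
        ((n : ℝ) + 1) ^ (-q) * inner ℝ (G.grad i (A n)) (A n i - b)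
        + M * (2 * M) * |w * (p i * s n) - ((n : ℝ) + 1) ^ (-q)| := by
      have h4 : |(w * (p i * s n) - ((n : ℝ) + 1) ^ (-q)) * inner ℝ (G.grad i (A n)) (A n i - b)|
          ≤ |w * (p i * s n) - ((n : ℝ) + 1) ^ (-q)| * (M * (2 * M)) := by
        rw [abs_mul]
        exact mul_le_mul_of_nonneg_left (hin n) (abs_nonneg _)
      have h5 := le_of_abs_le h4
      linarith
    linarith

include hq in
/-- Almost sure convergence of the intended actions, for directions in the unit ball. -/
theorem ae_tendsto_randomIntended (hmono : G.StrictlyMonotone) (hq' : q ≤ 1)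
    (hδs : Summable fun n : ℕ => ((n : ℝ) + 1) ^ (-q) * δ n)
    (hδs' : Summable fun n : ℕ => ((n : ℝ) + 1) ^ (-2 * q) * (δ n ^ 2)⁻¹)
    {b : G.Profile} (hb : G.IsNash b) :
    ∀ᵐ ω ∂P, Tendsto (fun n => G.randomIntended c r δ q a₁ lam I n ω) atTop (𝓝 b) := by
  filter_upwards [ae_all_iff.2 fun i =>
    h.ae_exists_descent hle hG hr hball hδ hδr hq hδs hδs' i (hb.1 i)] with ω hω
  choose e hS hstep using hω
  obtain ⟨S, hS⟩ := exists_tendsto_sum_range_sum (f := fun n i => e i n) hS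
  set A := fun n => G.randomIntended c r δ q a₁ lam I n ω with hAdef
  have hA : ∀ n, A n ∈ G.profiles := fun n => Game.intended_mem hG (h.init_mem ω) _ _ n
  set V : G.Profile → ℝ := fun a => ∑ i, p i ^ (q - 1) * ‖a i - b i‖ ^ 2 with hV
  set φ : G.Profile → ℝ := fun a => - ∑ i, 2 * inner ℝ (G.grad i a) (a i - b i) with hφ
  have hw : ∀ i, 0 < p i ^ (q - 1) := fun i => Real.rpow_pos_of_pos (h.prob_pos i) _
  have hφpos : ∀ a ∈ G.profiles, a ≠ b → 0 < φ a := fun a ha hne => by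
    have := hG.sum_inner_grad_neg hmono hb ha hne
    simp only [hφ, ← Finset.mul_sum]
    linarith
  have hφ0 : ∀ a ∈ G.profiles, 0 ≤ φ a := fun a ha => by
    by_cases hab : a = b
    · simp [hφ, hab]
    · exact (hφpos a ha hab).le
  have hVc : Continuous V := by simp only [hV]; fun_prop
  have hφc : ContinuousOn φ G.profiles := by
    refine ContinuousOn.neg (continuousOn_finsetSum _ fun i _ => ?_)
    exact continuousOn_const.mul ((hG.continuousOn_grad i).inner (by fun_prop))
  obtain ⟨⟨v, hv⟩, hfreq⟩ := tendsto_of_perturbed_descent (V := fun n => V (A n))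
    (φ := fun n => φ (A n)) (s := fun n : ℕ => ((n : ℝ) + 1) ^ (-q))
    (fun n => Finset.sum_nonneg fun i _ => mul_nonneg (hw i).le (sq_nonneg _))
    (fun n => hφ0 _ (hA n)) (fun n => by positivity) (not_summable_nat_succ_rpow hq') hS (by
      filter_upwards [eventually_all.2 hstep] with n hn
      have := Finset.sum_le_sum fun i (_ : i ∈ Finset.univ) => hn i
      simp only [Finset.sum_add_distrib, ← Finset.mul_sum] at this
      simp only [hV, hφ, ← Finset.mul_sum]
      linarith)
  -- With a positive limit the iterates would end up in a compact set avoiding `b`, where `φ` has a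
  -- positive minimum, against its being arbitrarily small infinitely often.
  have hv0 : v = 0 := by
    by_contra hne
    have hvpos : 0 < v := lt_of_le_of_ne (ge_of_tendsto' hv fun n =>
      Finset.sum_nonneg fun i _ => mul_nonneg (hw i).le (sq_nonneg _)) (Ne.symm hne)
    set T := G.profiles ∩ {a | v / 2 ≤ V a} with hT
    have hTc : IsCompact T := hG.isCompact_profiles.inter_right (isClosed_le continuous_const hVc)
    have hev : ∀ᶠ n in atTop, A n ∈ T := by
      filter_upwards [hv.eventually (lt_mem_nhds (half_lt_self hvpos))] with n hn
      exact ⟨hA n, le_of_lt hn⟩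
    obtain ⟨n₀, hn₀⟩ := hev.exists
    obtain ⟨z, hz, hmin⟩ := hTc.exists_isMinOn ⟨_, hn₀⟩ (hφc.mono Set.inter_subset_left)
    have hzb : z ≠ b := by
      rintro rfl
      have := hz.2
      simp [hV] at this
      linarith
    obtain ⟨n, hn1, hn2⟩ := ((hfreq _ (hφpos z hz.1 hzb)).and_eventually hev).exists
    exact absurd (hmin hn2) (not_le.2 hn1)
  rw [hv0] at hv
  refine tendsto_pi_nhds.2 fun i => ?_
  rw [tendsto_iff_norm_sub_tendsto_zero]
  have h1 : Tendsto (fun n => (p i ^ (q - 1))⁻¹ * V (A n)) atTop (𝓝 0) := by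
    simpa using hv.const_mul (p i ^ (q - 1))⁻¹
  have h2 : Tendsto (fun n => ‖A n i - b i‖ ^ 2) atTop (𝓝 0) := by
    refine squeeze_zero (fun n => sq_nonneg _) (fun n => ?_) h1
    rw [le_inv_mul_iff₀ (hw i)]
    exact Finset.single_le_sum (f := fun i => p i ^ (q - 1) * ‖A n i - b i‖ ^ 2)
      (fun j _ => mul_nonneg (hw j).le (sq_nonneg _)) (Finset.mem_univ i)
  have h3 := h2.sqrt
  simpa using h3

end SureBound

end LossyModel

/-! ### Reduction to surely bounded directions and conclusion -/

/-- Vectors outside the unit ball are replaced by `0`. -/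
noncomputable def unitBallTrunc {d : ℕ} (x : EuclideanSpace ℝ (Fin d)) : EuclideanSpace ℝ (Fin d) :=
  if ‖x‖ ≤ 1 then x else 0

theorem measurable_unitBallTrunc {d : ℕ} : Measurable (unitBallTrunc (d := d)) :=
  Measurable.ite (measurableSet_le measurable_norm measurable_const) measurable_id measurable_const

theorem norm_unitBallTrunc_le {d : ℕ} (x : EuclideanSpace ℝ (Fin d)) : ‖unitBallTrunc x‖ ≤ 1 := by
  unfold unitBallTrunc
  split_ifs with h
  · exact h
  · simp

theorem unitBallTrunc_ae_eq {d : ℕ} : ∀ᵐ x ∂unifSphere d, unitBallTrunc x = x := by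
  filter_upwards [ae_unifSphere_norm_eq_one] with x hx
  simp [unitBallTrunc, hx]

namespace LossyModel

variable {Ω : Type*} [mΩ : MeasurableSpace Ω] {P : Measure Ω} {N : ℕ}
  {G : Game N} {p : Fin N → ℝ} {a₁ : Ω → G.Profile}
  {lam : ∀ i, ℕ → Ω → EuclideanSpace ℝ (Fin (G.dim i))} {I : Fin N → ℕ → Ω → Bool}

/-- The directions may be modified on a null set so as to lie in the unit ball surely. -/
theorem trunc (h : LossyModel P G p a₁ lam I) :
    LossyModel P G p a₁ (fun i n ω => unitBallTrunc (lam i n ω)) I where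
  init_measurable := h.init_measurable
  init_mem := h.init_mem
  dir_measurable i n := measurable_unitBallTrunc.comp (h.dir_measurable i n)
  dir_law i n := by
    rw [← Function.comp_def, ← Measure.map_map measurable_unitBallTrunc (h.dir_measurable i n),
      h.dir_law, Measure.map_congr unitBallTrunc_ae_eq, Measure.map_id']
  feedback_measurable := h.feedback_measurable
  feedback_prob := h.feedback_prob
  prob_pos := h.prob_pos
  indep := by
    refine iIndep_of_iIndep_of_le h.indep fun s => ?_
    cases s with
    | init => exact le_rfl
    | dir i n =>
      exact (measurable_unitBallTrunc.comp (comap_measurable (lam i n))).comap_le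
    | feedback i n => exact le_rfl

theorem ae_trunc_eq (h : LossyModel P G p a₁ lam I) :
    ∀ᵐ ω ∂P, ∀ i n, unitBallTrunc (lam i n ω) = lam i n ω :=
  ae_all_iff.2 fun i => ae_all_iff.2 fun n =>
    ae_of_ae_map (h.dir_measurable i n).aemeasurable (by
      rw [h.dir_law]; exact unitBallTrunc_ae_eq)

end LossyModel

theorem theorem4 {Ω : Type*} [MeasurableSpace Ω] (P : Measure Ω) [IsProbabilityMeasure P]
    {N : ℕ} (G : Game N) (hG : G.Regular) (hmono : G.StrictlyMonotone)
    -- the random environment, with unknown feedback probabilities `p i`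
    (p : Fin N → ℝ) (a₁ : Ω → G.Profile)
    (lam : ∀ i, ℕ → Ω → EuclideanSpace ℝ (Fin (G.dim i)))
    (I : Fin N → ℕ → Ω → Bool) (hmodel : LossyModel P G p a₁ lam I)
    -- the safety balls
    (c : G.Profile) (r : Fin N → ℝ) (hr : ∀ i, 0 < r i)
    (hball : ∀ i, Metric.closedBall (c i) (r i) ⊆ G.act i)
    -- the exponent of the step sizes and the query radii (`δ n` is the radius of stage `n + 1`)
    (q : ℝ) (hq : 1 / 2 < q) (hq' : q ≤ 1)
    (δ : ℕ → ℝ) (hδ_pos : ∀ n, 0 < δ n) (hδ_anti : Antitone δ) (hδ_r : ∀ i, δ 0 < r i)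
    (hδ_lim : Tendsto δ atTop (𝓝 0))
    (hδ_sum : Summable fun n : ℕ => ((n : ℝ) + 1) ^ (-q) * δ n)
    (hδ_sum' : Summable fun n : ℕ => ((n : ℝ) + 1) ^ (-2 * q) * (δ n ^ 2)⁻¹) :
    ∃ aStar : G.Profile, G.IsNash aStar ∧ (∀ b, G.IsNash b → b = aStar) ∧
      ∀ᵐ ω ∂P, Tendsto
        (fun n => G.realized c r δ q (a₁ ω) (fun m i => lam i m ω) (fun i m => I i m ω) n)
        atTop (𝓝 aStar) := by
  obtain ⟨b, hb⟩ := hG.exists_isNash hmono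
  refine ⟨b, hb, fun b' hb' => hG.isNash_unique hmono hb hb', ?_⟩
  have hδr : ∀ n i, δ n ≤ r i := fun n i => (hδ_anti n.zero_le).trans (hδ_r i).le
  filter_upwards [hmodel.trunc.ae_tendsto_randomIntended (fun i n ω => norm_unitBallTrunc_le _) hG hr
    hball hδ_pos hδr hq hmono hq' hδ_sum hδ_sum' hb, hmodel.ae_trunc_eq] with ω hω hlam
  simp only [Game.randomIntended, hlam] at hω
  have hl : ∀ n i, ‖lam i n ω‖ ≤ 1 := fun n i => hlam i n ▸ norm_unitBallTrunc_le _
  refine tendsto_pi_nhds.2 fun i => ?_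
  have hωi := tendsto_pi_nhds.1 hω i
  have h0 : Tendsto (fun n => δ n * (1 + |(r i)⁻¹| * ‖G.intended c r δ q (a₁ ω)
      (fun m i => lam i m ω) (fun i m => I i m ω) n i - c i‖)) atTop (𝓝 0) := by
    have := hδ_lim.mul ((((hωi.sub_const (c i)).norm).const_mul |(r i)⁻¹|).const_add 1)
    simpa using this
  -- Realized and intended actions differ by `δ n` times a convergent factor, so both have the same
  -- limit.
  have h1 := squeeze_zero_norm (fun n => G.norm_perturb_sub_le (c := c) (r := r)
    (hδ_pos n).le (l := fun i => lam i n ω) (hl n i)) h0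
  have h2 := h1.add hωi
  simpa [Game.realized] using h2
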